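/- For $\beta\ge 0$ let $f_\beta\colon[-1,1]\to\mathbb R$ be either the Gaussian $f_\beta(x)=\exp(-\tfrac{\beta}{2}x^2)$ or the Kaiser window $f_\beta(x)=W_\beta(x)=I_0(\beta\sqrt{1-x^2})/I_0(\beta)$, where $I_0(z)=\sum_{k\ge 0}\frac{(z^2/4)^k}{(k!)^2}$ is the zeroth modified Bessel function of the first kind. For $n\in\mathbb N$ and $N=2^n$ let $$|\Psi_{f_\beta}\rangle=\frac{1}{\mathcal N}\sum_{x=0}^{N-1}f_\beta(\bar x)\,|x\rangle,\qquad \bar x=\frac{2x}{N}-1,\qquad \mathcal N=\Big(\sum_{x=0}^{N-1}|f_\beta(\bar x)|^2\Big)^{1/2},$$ be the corresponding $n$-qubit state. A state $|\Psi\rangle$ on $n$ qubits can be prepared up to precision $\varepsilon$ with $G$ gates if some circuit of at most $G$ gates, each an arbitrary single-qubit unitary or a CNOT, acting on the $n$ qubits and finitely many ancilla qubits, maps the all-zeros state to a state within trace distance $\varepsilon$ of $|\Psi\rangle|0\cdots0\rangle$. (i) There is a universal constant $C$ such that for all $n$, all $\beta\ge0$ with $2^n\ge\sqrt\beta$, all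 $\varepsilon\in(0,\tfrac12)$ and both choices of $f_\beta$, the state $|\Psi_{f_\beta}\rangle$ can be prepared up to precision $\varepsilon$ with at most $$C\,n\,(\beta+1)^{1/4}\,\big(\beta+\log(1/\varepsilon)\big)$$ gates. (ii) There is a universal constant $C$ such that for all $n$, $\beta$, $\varepsilon$ as in (i) which also satisfy $\beta\ge\log(1/\varepsilon)$, the state of the Gaussian $f_\beta(x)=\exp(-\tfrac{\beta}{2}x^2)$ can be prepared up to precision $\varepsilon$ with at most $$C\,n\,\log^{5/4}(1/\varepsilon)$$ gates. -/

import Mathlib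

/-- An elementary gate on the qubits labelled by `Q`: an arbitrary single-qubit unitary applied to
one qubit, or a controlled NOT between two different qubits. -/
inductive QGate (Q : Type) : Type
  | single (q : Q) (U : Matrix.unitaryGroup Bool ℂ) : QGate Q
  | cnot (control target : Q) (hne : control ≠ target) : QGate Q

/-- The action of a gate on a vector `ψ`, given by its amplitudes in the computational basis
`Q → Bool` (with `false` for the bit `0` and `true` for the bit `1`). -/
noncomputable def QGate.act {Q : Type} [DecidableEq Q] (g : QGate Q)
    (ψ : (Q → Bool) → ℂ) : (Q → Bool) → ℂ :=
  match g with
  | .single q U => fun x =>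
      ∑ b : Bool, (U : Matrix Bool Bool ℂ) (x q) b * ψ (Function.update x q b)
  | .cnot c t _ => fun x => ψ (if x c then Function.update x t (!(x t)) else x)

/-- A circuit is a list of gates, applied from left to right; its gate count is its length. -/
noncomputable def runCircuit {Q : Type} [DecidableEq Q] (gates : List (QGate Q))
    (ψ : (Q → Bool) → ℂ) : (Q → Bool) → ℂ :=
  gates.foldl (fun φ g => g.act φ) ψ

/-- The all-zeros computational basis state. -/
noncomputable def zeroState (Q : Type) [Fintype Q] : (Q → Bool) → ℂ :=
  Pi.single (fun _ => false) 1

/-- The rank-one operator `|ψ⟩⟨ψ|`. -/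
def pureDensity {ι : Type} (ψ : ι → ℂ) : Matrix ι ι ℂ :=
  Matrix.vecMulVec ψ (star ψ)

theorem pureDensity_isHermitian {ι : Type} (ψ : ι → ℂ) : (pureDensity ψ).IsHermitian := by
  ext i j
  simp [pureDensity, Matrix.vecMulVec_apply, mul_comm]

/-- The trace distance `½‖ρ - σ‖₁` of two Hermitian matrices; the trace norm of the Hermitian
matrix `ρ - σ` is the sum of the absolute values of its eigenvalues, with multiplicity. -/
noncomputable def traceDistance {ι : Type} [Fintype ι] [DecidableEq ι] {ρ σ : Matrix ι ι ℂ}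
    (hρ : ρ.IsHermitian) (hσ : σ.IsHermitian) : ℝ :=
  (1 / 2) * ∑ i, |(hρ.sub hσ).eigenvalues i|

/-- The integer in `{0, …, 2 ^ n - 1}` with binary digits `x`. -/
def bitsToNat {n : ℕ} (x : Fin n → Bool) : ℕ :=
  ∑ i : Fin n, if x i then 2 ^ (i : ℕ) else 0

/-- The grid point `(b - a) k / 2 ^ n + a` of the interval `[a, b]`. -/
noncomputable def gridPoint (a b : ℝ) (n k : ℕ) : ℝ :=
  (b - a) * k / 2 ^ n + a

/-- The normalization `(∑ₓ |f(x̄)|²)^{1/2}`, summed over the `2 ^ n` grid points of `[a, b]`. -/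
noncomputable def gridNorm (f : ℝ → ℝ) (a b : ℝ) (n : ℕ) : ℝ :=
  √(∑ k ∈ Finset.range (2 ^ n), |f (gridPoint a b n k)| ^ 2)

/-- The `n`-qubit state whose amplitude at `|x⟩` is proportional to the value of `f` at the
`x`-th grid point of `[a, b]`. -/
noncomputable def functionState (f : ℝ → ℝ) (a b : ℝ) (n : ℕ) : (Fin n → Bool) → ℂ :=
  fun x => ((f (gridPoint a b n (bitsToNat x)) / gridNorm f a b n : ℝ) : ℂ)

/-- The state `|Ψ⟩|0…0⟩` in which `m` ancilla qubits in the state `|0⟩` are adjoined to `Ψ`. -/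
noncomputable def withZeroAncillas {n : ℕ} (Ψ : (Fin n → Bool) → ℂ) (m : ℕ) :
    (Fin n ⊕ Fin m → Bool) → ℂ :=
  fun x => Ψ (fun i => x (Sum.inl i)) * zeroState (Fin m) (fun j => x (Sum.inr j))

/-- The `n`-qubit state `Ψ` can be prepared up to precision `ε` with at most `G` gates: some
circuit of at most `G` gates, acting on the `n` qubits and finitely many ancilla qubits, maps the
all-zeros state to a state within trace distance `ε` of `|Ψ⟩|0…0⟩`. -/
def CanPrepare {n : ℕ} (Ψ : (Fin n → Bool) → ℂ) (ε G : ℝ) : Prop :=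
  ∃ (m : ℕ) (gates : List (QGate (Fin n ⊕ Fin m))),
    (gates.length : ℝ) ≤ G ∧
    traceDistance
      (pureDensity_isHermitian (runCircuit gates (zeroState (Fin n ⊕ Fin m))))
      (pureDensity_isHermitian (withZeroAncillas Ψ m)) ≤ ε

/-- The zeroth modified Bessel function of the first kind, on the real line. -/
noncomputable def besselI0 (z : ℝ) : ℝ :=
  ∑' k : ℕ, (z ^ 2 / 4) ^ k / (k.factorial : ℝ) ^ 2

/-- The Gaussian `exp(-β x² / 2)`. -/
noncomputable def gaussianFun (β : ℝ) (x : ℝ) : ℝ :=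
  Real.exp (-(β / 2) * x ^ 2)

/-- The Kaiser window function. -/
noncomputable def kaiserWindow (β : ℝ) (x : ℝ) : ℝ :=
  besselI0 (β * √(1 - x ^ 2)) / besselI0 β

/-!
Both functions are mixtures of powers of `y = 1 - x ^ 2`: on `[-1, 1]`, `f x = ∑ k, w k * y ^ k`
with weights `w k ≥ 0` of sum `f 0 = 1` (`IsPowerMixture`). For the Gaussian the weights are those
of a Poisson distribution of mean `β / 2`, for the Kaiser window they are the normalized summands
of the Bessel function. Their exponential moments are at most `exp (2 * β)`, so that the mixture
may be truncated at a power `D` of the order of `β + log (1 / ε)`.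

The truncated mixture is the probability of an event that a randomized Boolean formula of size
`O(n D)` decides (`Samples`). Indeed `|x|` is the probability that a uniformly random number is on
one side of the binary expansion of `x`, so two such comparisons decide an event of probability
`y`, and Horner's scheme turns an event of probability `y` into one of probability
`∑ k ≤ D, w k * y ^ k`. Such a formula is run coherently, with its random bits purified by
ancillas. Running it forwards, flipping the sign of the amplitude according to the output, and
running it backwards multiplies the amplitude at `x`, in the component where the ancillas have
returned to `0`, by `2 * p x - 1`, where `p x` is the probability of the output `1`
(`Samples.exists_kickback`). This turns a probability into an amplitude. It also provides
reflections, when the output is deterministic.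

Starting from the uniform superposition of the grid points, the component of norm `a` proportional
to the desired state is isolated by amplitude amplification in `O(1 / a)` rounds
(`exists_amplify`, `exists_circuit_mul`). It is exact, since the function may be scaled down until
an odd multiple of the angle is a right angle. The norm `a` is the root mean square of `f` over
the grid, which is at least a constant times `(β + 1) ^ (-1 / 4)`, since `f` is bounded below for
`β * x ^ 2 ≤ 1` (`le_sum_window_sq`). This gives the first bound.

For the second bound, the Gaussian is negligible outside of a dyadic window `[-2⁻ʲ, 2⁻ʲ)` with
`β / 4 ^ j` of the order of `log (1 / ε)` (`sum_gaussianFun_not_inWindow_le`). The window consists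
of the bit strings whose `j` digits after the first are opposite to the first one, so its uniform
superposition is easy to prepare. On it the Gaussian is, in the rescaled variable `2 ^ j * x`, the
one with parameter `β / 4 ^ j`, and the first argument applies to this Gaussian.

The trace distance is bounded by the distance of the state vectors
(`traceDistance_pureDensity_le`).
-/

/-! ### Circuits as linear isometries -/

theorem zeroState_apply {Q : Type} [Fintype Q] (x : Q → Bool) :
    zeroState Q x = if x = (fun _ => false) then 1 else 0 := by
  simp [zeroState, Pi.single_apply]

section Definitions

variable {Q R : Type}

/-- The inverse of a gate. -/
noncomputable def QGate.inv : QGate Q → QGate Q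
  | .single q U => .single q U⁻¹
  | .cnot c t h => .cnot c t h

theorem QGate.inv_inv (g : QGate Q) : g.inv.inv = g := by
  cases g <;> simp [QGate.inv]

/-- The inverse circuit: the inverse gates in the opposite order. -/
noncomputable def invCircuit (c : List (QGate Q)) : List (QGate Q) := (c.map QGate.inv).reverse

theorem length_invCircuit (c : List (QGate Q)) : (invCircuit c).length = c.length := by
  simp [invCircuit]

/-- The gate `g` acting on the wires `e q` in place of `q`. -/
def QGate.map (e : Q → R) (he : Function.Injective e) : QGate Q → QGate R
  | .single q U => .single (e q) U
  | .cnot c t h => .cnot (e c) (e t) (he.ne h)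

/-- The circuit `c` acting on the wires `e q` in place of `q`. -/
def mapCircuit (e : Q → R) (he : Function.Injective e) (c : List (QGate Q)) : List (QGate R) :=
  c.map (QGate.map e he)

theorem length_mapCircuit (e : Q → R) (he : Function.Injective e) (c : List (QGate Q)) :
    (mapCircuit e he c).length = c.length := by
  simp [mapCircuit]

/-- The restriction of `ψ` to the assignments that agree with `z` off the wires `e q`. -/
noncomputable def slice (e : Q → R) (z : R → Bool) (ψ : (R → Bool) → ℂ) : (Q → Bool) → ℂ :=
  fun w => ψ (Function.extend e w z)

theorem extend_comp_self (e : Q → R) (he : Function.Injective e) (z : R → Bool) :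
    Function.extend e (fun q => z (e q)) z = z := by
  ext r
  by_cases h : ∃ q', e q' = r
  · obtain ⟨q', rfl⟩ := h
    rw [he.extend_apply]
  · rw [Function.extend_apply' _ _ _ h]

end Definitions

section Circuits

variable {Q R : Type} [DecidableEq Q] [DecidableEq R]

theorem QGate.act_add (g : QGate Q) (u v : (Q → Bool) → ℂ) :
    g.act (u + v) = g.act u + g.act v := by
  cases g <;> ext x <;> simp [QGate.act, mul_add] ; ring

theorem QGate.act_smul (g : QGate Q) (a : ℂ) (v : (Q → Bool) → ℂ) :
    g.act (a • v) = a • g.act v := by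
  cases g <;> ext x <;> simp [QGate.act] ; ring

theorem runCircuit_nil (ψ : (Q → Bool) → ℂ) : runCircuit [] ψ = ψ := rfl

theorem runCircuit_cons (g : QGate Q) (c : List (QGate Q)) (ψ : (Q → Bool) → ℂ) :
    runCircuit (g :: c) ψ = runCircuit c (g.act ψ) := rfl

theorem runCircuit_append (c d : List (QGate Q)) (ψ : (Q → Bool) → ℂ) :
    runCircuit (c ++ d) ψ = runCircuit d (runCircuit c ψ) := by
  simp [runCircuit]

theorem runCircuit_add (c : List (QGate Q)) (u v : (Q → Bool) → ℂ) :
    runCircuit c (u + v) = runCircuit c u + runCircuit c v := by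
  induction c generalizing u v with
  | nil => rfl
  | cons g c ih => rw [runCircuit_cons, QGate.act_add, ih]; rfl

theorem runCircuit_smul (c : List (QGate Q)) (a : ℂ) (v : (Q → Bool) → ℂ) :
    runCircuit c (a • v) = a • runCircuit c v := by
  induction c generalizing v with
  | nil => rfl
  | cons g c ih => rw [runCircuit_cons, QGate.act_smul, ih]; rfl

theorem QGate.act_inv_act (g : QGate Q) (ψ : (Q → Bool) → ℂ) : g.inv.act (g.act ψ) = ψ := by
  cases g with
  | single q U =>
    ext x
    have h : (star (U : Matrix Bool Bool ℂ)) * (U : Matrix Bool Bool ℂ) = 1 := U.2.1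
    have h2 : ∀ b b', ∑ k, (star (U : Matrix Bool Bool ℂ)) b k * (U : Matrix Bool Bool ℂ) k b'
        = if b = b' then 1 else 0 := by
      intro b b'
      rw [← Matrix.mul_apply, h, Matrix.one_apply]
    simp only [QGate.inv, QGate.act, Function.update_self, Function.update_idem, Finset.mul_sum]
    rw [Finset.sum_comm]
    simp only [← mul_assoc, ← Finset.sum_mul]
    have h3 : ∀ b, ∑ k, ((U⁻¹ : Matrix.unitaryGroup Bool ℂ) : Matrix Bool Bool ℂ) (x q) k *
        (U : Matrix Bool Bool ℂ) k b = if x q = b then 1 else 0 := fun b => h2 _ _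
    simp only [h3, ite_mul, one_mul, zero_mul, Finset.sum_ite_eq, Finset.mem_univ, if_true,
      Function.update_eq_self]
  | cnot c t h =>
    ext x
    by_cases hc : x c
    · simp [QGate.inv, QGate.act, hc, Function.update_of_ne h]
    · simp [QGate.inv, QGate.act, hc]

theorem runCircuit_invCircuit (c : List (QGate Q)) (ψ : (Q → Bool) → ℂ) :
    runCircuit (invCircuit c) (runCircuit c ψ) = ψ := by
  induction c generalizing ψ with
  | nil => rfl
  | cons g c ih =>
    have : invCircuit (g :: c) = invCircuit c ++ [g.inv] := by simp [invCircuit]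
    rw [this, runCircuit_append, runCircuit_cons, runCircuit_cons, ih, runCircuit_nil,
      QGate.act_inv_act]

theorem runCircuit_runCircuit_invCircuit (c : List (QGate Q)) (ψ : (Q → Bool) → ℂ) :
    runCircuit c (runCircuit (invCircuit c) ψ) = ψ := by
  have h := runCircuit_invCircuit (invCircuit c) ψ
  have : invCircuit (invCircuit c) = c := by
    simp [invCircuit, Function.comp_def, QGate.inv_inv]
  rwa [this] at h

theorem extend_update (e : Q → R) (he : Function.Injective e) (w : Q → Bool) (z : R → Bool)
    (q : Q) (b : Bool) :
    Function.extend e (Function.update w q b) z =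
      Function.update (Function.extend e w z) (e q) b := by
  ext r
  by_cases h : ∃ q', e q' = r
  · obtain ⟨q', rfl⟩ := h
    rw [he.extend_apply]
    by_cases hq : q' = q
    · subst hq; simp
    · rw [Function.update_of_ne hq, Function.update_of_ne (he.ne hq), he.extend_apply]
  · rw [Function.extend_apply' _ _ _ h, Function.update_of_ne, Function.extend_apply' _ _ _ h]
    rintro rfl
    exact h ⟨q, rfl⟩

theorem slice_act (e : Q → R) (he : Function.Injective e) (g : QGate Q) (z : R → Bool)
    (ψ : (R → Bool) → ℂ) : slice e z ((g.map e he).act ψ) = g.act (slice e z ψ) := by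
  ext w
  cases g with
  | single q U => simp [slice, QGate.act, QGate.map, he.extend_apply, extend_update e he]
  | cnot c t h =>
    simp only [slice, QGate.act, QGate.map, he.extend_apply]
    split_ifs <;> simp [extend_update e he]

theorem slice_runCircuit (e : Q → R) (he : Function.Injective e) (c : List (QGate Q))
    (z : R → Bool) (ψ : (R → Bool) → ℂ) :
    slice e z (runCircuit (mapCircuit e he c) ψ) = runCircuit c (slice e z ψ) := by
  induction c generalizing ψ with
  | nil => rfl
  | cons g c ih =>
    rw [runCircuit_cons, ← slice_act e he, ← ih]
    rfl

theorem runCircuit_mapCircuit_apply (e : Q → R) (he : Function.Injective e)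
    (c : List (QGate Q)) (z : R → Bool) (ψ : (R → Bool) → ℂ) :
    runCircuit (mapCircuit e he c) ψ z = runCircuit c (slice e z ψ) (fun q => z (e q)) := by
  rw [← slice_runCircuit e he, slice, extend_comp_self e he]

variable [Fintype Q]

theorem QGate.adjoint (g : QGate Q) (u v : (Q → Bool) → ℂ) :
    ∑ x, star (g.act u x) * v x = ∑ x, star (u x) * g.inv.act v x := by
  cases g with
  | single q U =>
    simp only [QGate.inv, QGate.act, star_sum, Finset.sum_mul, Finset.mul_sum]
    rw [← Fintype.sum_prod_type', ← Fintype.sum_prod_type']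
    refine Finset.sum_nbij' (fun p => (Function.update p.1 q p.2, p.1 q))
      (fun p => (Function.update p.1 q p.2, p.1 q)) ?_ ?_ ?_ ?_ ?_
    · simp
    · simp
    · rintro ⟨x, b⟩ _; simp
    · rintro ⟨x, b⟩ _; simp
    · rintro ⟨x, b⟩ _
      have : ∀ b b', ((U⁻¹ : Matrix.unitaryGroup Bool ℂ) : Matrix Bool Bool ℂ) b b' =
        star ((U : Matrix Bool Bool ℂ) b' b) := fun b b' => rfl
      simp [this]
      ring
  | cnot c t h =>
    have hinv : ∀ x : Q → Bool, (fun x : Q → Bool =>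
        if x c then Function.update x t (!(x t)) else x) ((fun x : Q → Bool =>
        if x c then Function.update x t (!(x t)) else x) x) = x := by
      intro x
      by_cases hc : x c <;> simp [hc, Function.update_of_ne h]
    refine Finset.sum_nbij' (fun x => if x c then Function.update x t (!(x t)) else x)
      (fun x => if x c then Function.update x t (!(x t)) else x) (by simp) (by simp)
      (fun x _ => hinv x) (fun x _ => hinv x) (fun x _ => ?_)
    have := hinv x
    simp only at this
    simp only [QGate.act, QGate.inv, this]

theorem runCircuit_adjoint (c : List (QGate Q)) (u v : (Q → Bool) → ℂ) :
    ∑ x, star (runCircuit c u x) * v x = ∑ x, star (u x) * runCircuit (invCircuit c) v x := by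
  induction c generalizing u v with
  | nil => rfl
  | cons g c ih =>
    have : invCircuit (g :: c) = invCircuit c ++ [g.inv] := by simp [invCircuit]
    rw [this, runCircuit_append, runCircuit_cons, ih, QGate.adjoint]
    rfl

theorem runCircuit_isometry (c : List (QGate Q)) (u : (Q → Bool) → ℂ) :
    ∑ x, ‖runCircuit c u x‖ ^ 2 = ∑ x, ‖u x‖ ^ 2 := by
  have h := runCircuit_adjoint c u (runCircuit c u)
  rw [runCircuit_invCircuit] at h
  have h2 : ∀ z : ℂ, star z * z = ((‖z‖ ^ 2 : ℝ) : ℂ) := by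
    intro z
    have := Complex.conj_mul' z
    push_cast
    simpa using this
  simp only [h2] at h
  exact_mod_cast h

theorem runCircuit_invCircuit_apply (c : List (QGate Q)) (v : (Q → Bool) → ℂ) (z : Q → Bool) :
    runCircuit (invCircuit c) v z = ∑ x, star (runCircuit c (Pi.single z 1) x) * v x := by
  rw [runCircuit_adjoint]
  simp [Pi.single_apply, apply_ite]

end Circuits

/-! ### Circuits that sample a random bit in superposition -/

/-- The state `|ψ⟩|0…0⟩` in which ancilla qubits labelled by `A` are adjoined to `ψ`. -/
noncomputable def adjoinZero {X : Type} (A : Type) [Fintype A] (ψ : (X → Bool) → ℂ) :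
    (X ⊕ A → Bool) → ℂ :=
  fun z => ψ (fun x => z (Sum.inl x)) * zeroState A (fun a => z (Sum.inr a))

/-- The circuit `c` acts by `|x⟩|0⟩ ↦ |x⟩|φ x⟩` on the computational basis states `x` of the qubits
labelled by `X`, and linearly. -/
def PreparesFibrewise {X A : Type} [Fintype A] [DecidableEq X] [DecidableEq A]
    (c : List (QGate (X ⊕ A))) (φ : (X → Bool) → (A → Bool) → ℂ) : Prop :=
  ∀ ψ : (X → Bool) → ℂ, runCircuit c (adjoinZero A ψ) =
    fun z => ψ (fun x => z (Sum.inl x)) * φ (fun x => z (Sum.inl x)) (fun a => z (Sum.inr a))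

/-- Running such a circuit on part of a larger register: the amplitude `χ` of the other wires,
which does not depend on the ancillas, is a spectator. -/
theorem PreparesFibrewise.run_map {X A R : Type} [Fintype A] [DecidableEq X] [DecidableEq A]
    [DecidableEq R] {c : List (QGate (X ⊕ A))} {φ : (X → Bool) → (A → Bool) → ℂ}
    (h : PreparesFibrewise c φ) (e : X ⊕ A → R) (he : Function.Injective e)
    (χ : (R → Bool) → ℂ)
    (hχ : ∀ z z' : R → Bool, (∀ r, (∀ a, e (Sum.inr a) ≠ r) → z r = z' r) → χ z = χ z') :
    runCircuit (mapCircuit e he c)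
        (fun z => χ z * zeroState A (fun a => z (e (Sum.inr a)))) =
      fun z => χ z * φ (fun x => z (e (Sum.inl x))) (fun a => z (e (Sum.inr a))) := by
  ext z
  rw [runCircuit_mapCircuit_apply]
  have h1 : slice e z (fun z => χ z * zeroState A (fun a => z (e (Sum.inr a)))) =
      adjoinZero A (fun v => χ (Function.extend e (Sum.elim v (fun _ => false)) z)) := by
    ext w
    simp only [slice, adjoinZero, he.extend_apply]
    congr 1
    apply hχ
    intro r hr
    by_cases hq : ∃ q, e q = r
    · obtain ⟨q, rfl⟩ := hq
      rw [he.extend_apply, he.extend_apply]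
      cases q with
      | inl x => rfl
      | inr a => exact absurd rfl (hr a)
    · rw [Function.extend_apply' _ _ _ hq, Function.extend_apply' _ _ _ hq]
  rw [h1, h]
  refine congrArg₂ (· * ·) (hχ _ _ ?_) rfl
  intro r hr
  by_cases hq : ∃ q, e q = r
  · obtain ⟨q, rfl⟩ := hq
    rw [he.extend_apply]
    cases q with
    | inl x => rfl
    | inr a => exact absurd rfl (hr a)
  · rw [Function.extend_apply' _ _ _ hq]

/-- The real rotation `|0⟩ ↦ a|0⟩ + b|1⟩`, `|1⟩ ↦ -b|0⟩ + a|1⟩`. -/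
noncomputable def realRotation (a b : ℝ) (h : a ^ 2 + b ^ 2 = 1) : Matrix.unitaryGroup Bool ℂ :=
  ⟨Matrix.of fun i j => if i = j then (a : ℂ) else if i then (b : ℂ) else -(b : ℂ), by
    have h' : (a : ℂ) ^ 2 + (b : ℂ) ^ 2 = 1 := by exact_mod_cast h
    rw [Matrix.mem_unitaryGroup_iff]
    ext i j
    cases i <;> cases j <;>
      simp [Matrix.mul_apply, Matrix.star_apply] <;> first | ring1 | linear_combination h'⟩

theorem realRotation_act {R : Type} [DecidableEq R] (a b : ℝ) (h : a ^ 2 + b ^ 2 = 1) (q : R)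
    (ψ : (R → Bool) → ℂ) (z : R → Bool) :
    (QGate.single q (realRotation a b h)).act ψ z =
      if z q then b * ψ (Function.update z q false) + a * ψ (Function.update z q true)
      else a * ψ (Function.update z q false) - b * ψ (Function.update z q true) := by
  cases hq : z q <;> simp [QGate.act, realRotation, hq] <;> ring

/-- The Toffoli gate on bit strings. -/
def toffoliFun {R : Type} [DecidableEq R] (c₁ c₂ t : R) (z : R → Bool) : R → Bool :=
  if z c₁ && z c₂ then Function.update z t (!(z t)) else z

/-- The phase by which `toffoliCircuit` differs from the Toffoli gate. -/
def toffoliPhase {R : Type} (c₁ c₂ t : R) (z : R → Bool) : ℂ :=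
  if z c₁ && !(z c₂) && z t then -1 else 1

/-- Margolus' circuit of three CNOTs and four rotations for the Toffoli gate up to a phase. -/
noncomputable def toffoliCircuit {R : Type} (c₁ c₂ t : R) (h₁ : c₁ ≠ t) (h₂ : c₂ ≠ t) :
    List (QGate R) :=
  let A := realRotation (Real.cos (Real.pi / 8)) (Real.sin (Real.pi / 8)) (Real.cos_sq_add_sin_sq _)
  let B := realRotation (Real.cos (Real.pi / 8)) (-Real.sin (Real.pi / 8))
    (by rw [neg_sq]; exact Real.cos_sq_add_sin_sq _)
  [.single t A, .cnot c₂ t h₂, .single t A, .cnot c₁ t h₁, .single t B, .cnot c₂ t h₂, .single t B]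

theorem cnot_act {R : Type} [DecidableEq R] (c t : R) (h : c ≠ t) (ψ : (R → Bool) → ℂ)
    (z : R → Bool) : (QGate.cnot c t h).act ψ z =
      ψ (if z c then Function.update z t (!(z t)) else z) := rfl

/-- With `r = cos α` and `s = sin α`, the hypothesis `hrs` says that `cos (2 * α) = sin (2 * α)`,
which holds for `α = π / 8`. -/
theorem runCircuit_rotations_cnots {R : Type} [DecidableEq R] (c₁ c₂ t : R) (h₁ : c₁ ≠ t)
    (h₂ : c₂ ≠ t) (r s : ℝ) (hA : r ^ 2 + s ^ 2 = 1) (hB : r ^ 2 + (-s) ^ 2 = 1)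
    (hrs : r ^ 2 - s ^ 2 = 2 * s * r) (ψ : (R → Bool) → ℂ) (z : R → Bool) :
    runCircuit [.single t (realRotation r s hA), .cnot c₂ t h₂, .single t (realRotation r s hA),
      .cnot c₁ t h₁, .single t (realRotation r (-s) hB), .cnot c₂ t h₂,
      .single t (realRotation r (-s) hB)] ψ z =
      toffoliPhase c₁ c₂ t z * ψ (toffoliFun c₁ c₂ t z) := by
  have e1 : (r : ℂ) ^ 2 + (s : ℂ) ^ 2 = 1 := by exact_mod_cast hA
  have e2 : (r : ℂ) ^ 2 - (s : ℂ) ^ 2 = 2 * s * r := by exact_mod_cast hrs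
  simp only [runCircuit_cons, runCircuit_nil, realRotation_act]
  have hu : Function.update z t (z t) = z := Function.update_eq_self _ _
  cases k1 : z c₁ <;> cases k2 : z c₂ <;> cases k3 : z t <;> rw [k3] at hu <;>
    simp [cnot_act, realRotation_act, toffoliFun, toffoliPhase, k1, k2, k3,
      Function.update_of_ne h₁, Function.update_of_ne h₂, hu] <;>
    clear hA hB hrs k1 k2 k3 hu <;> grind

theorem runCircuit_toffoliCircuit {R : Type} [DecidableEq R] (c₁ c₂ t : R) (h₁ : c₁ ≠ t)
    (h₂ : c₂ ≠ t) (ψ : (R → Bool) → ℂ) (z : R → Bool) :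
    runCircuit (toffoliCircuit c₁ c₂ t h₁ h₂) ψ z =
      toffoliPhase c₁ c₂ t z * ψ (toffoliFun c₁ c₂ t z) := by
  refine runCircuit_rotations_cnots c₁ c₂ t h₁ h₂ _ _ _ _ ?_ ψ z
  have a1 := Real.cos_sq' (Real.pi / 8)
  have a2 := Real.cos_two_mul (Real.pi / 8)
  have a3 := Real.sin_two_mul (Real.pi / 8)
  have : 2 * (Real.pi / 8) = Real.pi / 4 := by ring
  rw [this, Real.cos_pi_div_four] at a2
  rw [this, Real.sin_pi_div_four] at a3
  linarith

/-- A circuit of at most `G` gates, on at most `G` ancillas, samples a bit that is `1` with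
probability `p x`: on the basis state `x` and ancillas in the state `0`, it prepares an ancilla
state `φ x` in which the output qubit `o` has this distribution. The randomness is purified, so
the circuit can be run backwards. -/
def Samples {X : Type} [DecidableEq X] (p : (X → Bool) → ℝ) (G : ℕ) : Prop :=
  ∃ (A : Type) (_ : Fintype A) (_ : DecidableEq A) (c : List (QGate (X ⊕ A))) (o : A)
    (φ : (X → Bool) → (A → Bool) → ℂ),
    c.length ≤ G ∧ Fintype.card A ≤ G ∧ PreparesFibrewise c φ ∧
    ∀ x, (∑ a, if a o then ‖φ x a‖ ^ 2 else 0) = p x ∧ ∑ a, ‖φ x a‖ ^ 2 = 1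

section Samples

variable {X : Type} [DecidableEq X]

theorem Samples.mono {p : (X → Bool) → ℝ} {G G' : ℕ} (h : Samples p G) (hG : G ≤ G') :
    Samples p G' := by
  obtain ⟨A, i1, i2, c, o, φ, h1, h2, h3⟩ := h
  exact ⟨A, i1, i2, c, o, φ, h1.trans hG, h2.trans hG, h3⟩

theorem sum_unit_arrow {M : Type} [AddCommMonoid M] (f : (Unit → Bool) → M) :
    ∑ a, f a = f (fun _ => true) + f (fun _ => false) := by
  rw [← (Equiv.funUnique Unit Bool).symm.sum_comp]
  simp [Equiv.funUnique]
  rfl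

theorem sum_arrow_sum {A B : Type} [Fintype A] [DecidableEq A] [Fintype B] [DecidableEq B]
    {M : Type} [CommSemiring M] (f : (A → Bool) → M) (g : (B → Bool) → M) :
    ∑ y : A ⊕ B → Bool, f (fun a => y (Sum.inl a)) * g (fun b => y (Sum.inr b)) =
      (∑ a, f a) * ∑ b, g b := by
  rw [Finset.sum_mul_sum, ← Fintype.sum_prod_type',
    ← (Equiv.sumArrowEquivProdArrow A B Bool).sum_comp]
  rfl

theorem Samples.coin (p : ℝ) (h0 : 0 ≤ p) (h1 : p ≤ 1) :
    Samples (fun _ : X → Bool => p) 1 := by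
  refine ⟨Unit, inferInstance, inferInstance,
    [.single (Sum.inr ()) (realRotation √(1 - p) √p (by
      rw [Real.sq_sqrt (by linarith), Real.sq_sqrt h0]; ring))], (),
    fun _ a => if a () then (√p : ℂ) else (√(1 - p) : ℂ), by simp, by simp, ?_, ?_⟩
  · intro ψ
    ext z
    have hf : (fun _ : Unit => true) ≠ fun _ => false := fun h => by
      simpa using congrFun h ()
    rw [runCircuit_cons, runCircuit_nil, realRotation_act]
    by_cases hb : z (Sum.inr ()) <;>
      simp [adjoinZero, zeroState_apply, hf, hb, mul_comm]
  · intro x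
    simp [sum_unit_arrow, Real.sq_sqrt h0, Real.sq_sqrt (sub_nonneg.2 h1)]

theorem Samples.var (x : X) : Samples (fun v : X → Bool => if v x then 1 else 0) 1 := by
  refine ⟨Unit, inferInstance, inferInstance, [.cnot (Sum.inl x) (Sum.inr ()) (by simp)], (),
    fun v a => if a () = v x then 1 else 0, by simp, by simp, ?_, ?_⟩
  · intro ψ
    ext z
    rw [runCircuit_cons, runCircuit_nil]
    have hz : ∀ f : Unit → Bool, f = (fun _ => false) ↔ f () = false := by
      intro f
      exact ⟨fun h => by rw [h], fun h => by ext; exact h⟩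
    cases h : z (Sum.inl x) <;>
      simp [adjoinZero, QGate.act, h, zeroState_apply, hz]
  · intro v
    cases h : v x <;> simp [sum_unit_arrow, h]

/-- The permutation by which `if a then b else c` is computed into the wire of `c`. -/
def muxFun {Y : Type} [DecidableEq Y] (a b c : Y) (z : Y → Bool) : Y → Bool :=
  toffoliFun c c b (toffoliFun a b c z)

/-- Drawing the output of one of two samplers according to the output of a third. The three
samplers use separate ancillas, so that their outputs are independent. -/
theorem Samples.ite {p q r : (X → Bool) → ℝ} {G₁ G₂ G₃ : ℕ} (hp : Samples p G₁)
    (hq : Samples q G₂) (hr : Samples r G₃) :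
    Samples (fun x => p x * q x + (1 - p x) * r x) (G₁ + G₂ + G₃ + 8) := by
  obtain ⟨A, i1, i2, cA, oA, φA, hA1, hA2, hA3, hA4⟩ := hp
  obtain ⟨B, i3, i4, cB, oB, φB, hB1, hB2, hB3, hB4⟩ := hq
  obtain ⟨C, i5, i6, cC, oC, φC, hC1, hC2, hC3, hC4⟩ := hr
  let eA : X ⊕ A → X ⊕ (A ⊕ (B ⊕ C)) := Sum.map id Sum.inl
  let eB : X ⊕ B → X ⊕ (A ⊕ (B ⊕ C)) := Sum.map id (Sum.inr ∘ Sum.inl)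
  let eC : X ⊕ C → X ⊕ (A ⊕ (B ⊕ C)) := Sum.map id (Sum.inr ∘ Sum.inr)
  have heA : Function.Injective eA :=
    Function.Injective.sumMap Function.injective_id Sum.inl_injective
  have heB : Function.Injective eB := Function.Injective.sumMap Function.injective_id
    (Sum.inr_injective.comp Sum.inl_injective)
  have heC : Function.Injective eC := Function.Injective.sumMap Function.injective_id
    (Sum.inr_injective.comp Sum.inr_injective)
  let wA : A ⊕ (B ⊕ C) := Sum.inl oA
  let wB : A ⊕ (B ⊕ C) := Sum.inr (Sum.inl oB)
  let wC : A ⊕ (B ⊕ C) := Sum.inr (Sum.inr oC)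
  let Φ : (X → Bool) → (A ⊕ (B ⊕ C) → Bool) → ℂ := fun x y =>
    φA x (fun a => y (Sum.inl a)) * φB x (fun b => y (Sum.inr (Sum.inl b))) *
      φC x (fun c => y (Sum.inr (Sum.inr c)))
  refine ⟨A ⊕ (B ⊕ C), inferInstance, inferInstance,
    mapCircuit eA heA cA ++ (mapCircuit eB heB cB ++ (mapCircuit eC heC cC ++
      (QGate.cnot (Sum.inr wC) (Sum.inr wB) (by simp [wB, wC]) ::
        toffoliCircuit (Sum.inr wA) (Sum.inr wB) (Sum.inr wC) (by simp [wA, wC])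
          (by simp [wB, wC])))), wC,
    fun x y => toffoliPhase wA wB wC y * Φ x (muxFun wA wB wC y), ?_, ?_, ?_, ?_⟩
  · simp only [List.length_append, length_mapCircuit, List.length_cons, toffoliCircuit,
      List.length_nil]
    omega
  · simp only [Fintype.card_sum]
    omega
  · intro ψ
    have s1 : adjoinZero (A ⊕ (B ⊕ C)) ψ = fun z =>
        (ψ (fun x => z (Sum.inl x)) * zeroState B (fun b => z (eB (Sum.inr b))) *
          zeroState C (fun c => z (eC (Sum.inr c)))) * zeroState A (fun a => z (eA (Sum.inr a))) := by
      ext z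
      have : (fun a : A ⊕ (B ⊕ C) => z (Sum.inr a)) = (fun _ => false) ↔
          ((fun b => z (eB (Sum.inr b))) = (fun _ => false) ∧
          (fun b => z (eC (Sum.inr b))) = (fun _ => false)) ∧
          (fun b => z (eA (Sum.inr b))) = (fun _ => false) := by
        simp only [funext_iff, Sum.forall, eA, eB, eC, Sum.map_inr, Function.comp]
        tauto
      simp only [adjoinZero, zeroState_apply, this]
      split_ifs <;> simp_all
    rw [runCircuit_append, s1, hA3.run_map]
    swap
    · intro z z' hz
      have z1 : ∀ x, z (Sum.inl x) = z' (Sum.inl x) := fun x => hz _ (by simp [eA])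
      have z2 : ∀ b, z (eB (Sum.inr b)) = z' (eB (Sum.inr b)) := fun x => hz _ (by simp [eA, eB])
      have z3 : ∀ b, z (eC (Sum.inr b)) = z' (eC (Sum.inr b)) := fun x => hz _ (by simp [eA, eC])
      simp only [z1, z2, z3]
    have s2 : (fun z : X ⊕ (A ⊕ (B ⊕ C)) → Bool => ψ (fun x => z (Sum.inl x)) *
        zeroState B (fun b => z (eB (Sum.inr b))) * zeroState C (fun c => z (eC (Sum.inr c))) *
        φA (fun x => z (eA (Sum.inl x))) (fun a => z (eA (Sum.inr a)))) = fun z =>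
        (ψ (fun x => z (Sum.inl x)) * zeroState C (fun c => z (eC (Sum.inr c))) *
          φA (fun x => z (eA (Sum.inl x))) (fun a => z (eA (Sum.inr a)))) *
        zeroState B (fun b => z (eB (Sum.inr b))) := by
      ext z; ring
    rw [runCircuit_append, s2, hB3.run_map]
    swap
    · intro z z' hz
      have z1 : ∀ x, z (Sum.inl x) = z' (Sum.inl x) := fun x => hz _ (by simp [eB])
      have z2 : ∀ b, z (eA b) = z' (eA b) := fun x => hz _ (by cases x <;> simp [eA, eB])
      have z3 : ∀ b, z (eC (Sum.inr b)) = z' (eC (Sum.inr b)) := fun x => hz _ (by simp [eB, eC])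
      simp only [z1, z2, z3]
    have s3 : (fun z : X ⊕ (A ⊕ (B ⊕ C)) → Bool => ψ (fun x => z (Sum.inl x)) *
        zeroState C (fun c => z (eC (Sum.inr c))) *
        φA (fun x => z (eA (Sum.inl x))) (fun a => z (eA (Sum.inr a))) *
        φB (fun x => z (eB (Sum.inl x))) (fun a => z (eB (Sum.inr a)))) = fun z =>
        (ψ (fun x => z (Sum.inl x)) *
        φA (fun x => z (eA (Sum.inl x))) (fun a => z (eA (Sum.inr a))) *
        φB (fun x => z (eB (Sum.inl x))) (fun a => z (eB (Sum.inr a)))) *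
        zeroState C (fun c => z (eC (Sum.inr c))) := by
      ext z; ring
    rw [runCircuit_append, s3, hC3.run_map]
    swap
    · intro z z' hz
      have z1 : ∀ x, z (Sum.inl x) = z' (Sum.inl x) := fun x => hz _ (by simp [eC])
      have z2 : ∀ b, z (eA b) = z' (eA b) := fun x => hz _ (by cases x <;> simp [eA, eC])
      have z3 : ∀ b, z (eB b) = z' (eB b) := fun x => hz _ (by cases x <;> simp [eB, eC])
      simp only [z1, z2, z3]
    ext z
    rw [runCircuit_cons, runCircuit_toffoliCircuit]
    have p1 : toffoliPhase (Sum.inr wA) (Sum.inr wB) (Sum.inr wC) z =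
        toffoliPhase wA wB wC (fun y => z (Sum.inr y)) := rfl
    -- the permutations of the full register restrict to permutations of the ancillas
    have p2 : ∀ (u v w : A ⊕ (B ⊕ C)) (z : X ⊕ (A ⊕ (B ⊕ C)) → Bool),
        toffoliFun (Sum.inr u) (Sum.inr v) (Sum.inr w) z =
        Sum.elim (fun x => z (Sum.inl x)) (toffoliFun u v w (fun y => z (Sum.inr y))) := by
      intro u v w z
      ext s
      unfold toffoliFun
      rcases s with s | s <;> split_ifs <;> simp [Function.update_apply]
    have p3 : ∀ (F : (X ⊕ (A ⊕ (B ⊕ C)) → Bool) → ℂ) (h) (z),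
        (QGate.cnot (Sum.inr wC) (Sum.inr wB) h).act F z =
          F (toffoliFun (Sum.inr wC) (Sum.inr wC) (Sum.inr wB) z) := by
      intro F h z
      simp [QGate.act, toffoliFun]
    rw [p1, p3, p2, p2]
    simp only [Sum.elim_inl, Sum.elim_inr, eA, eB, eC, Sum.map_inl, Sum.map_inr, id,
      Function.comp, Φ, muxFun]
    ring
  · intro x
    have inv : ∀ (u v w : A ⊕ (B ⊕ C)), u ≠ w → v ≠ w → ∀ y,
        toffoliFun u v w (toffoliFun u v w y) = y := by
      intro u v w h1 h2 y
      unfold toffoliFun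
      by_cases hy : y u && y v <;> simp [hy, Function.update_of_ne h1, Function.update_of_ne h2]
    have nBC : wC ≠ wB := by simp [wB, wC]
    have nAC : wA ≠ wC := by simp [wA, wC]
    have nAB : wA ≠ wB := by simp [wA, wB]
    let e : (A ⊕ (B ⊕ C) → Bool) ≃ (A ⊕ (B ⊕ C) → Bool) :=
      { toFun := muxFun wA wB wC
        invFun := fun y => toffoliFun wA wB wC (toffoliFun wC wC wB y)
        left_inv := fun y => by
          simp only [muxFun]; rw [inv _ _ _ nBC nBC, inv _ _ _ nAC nBC.symm]
        right_inv := fun y => by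
          simp only [muxFun]; rw [inv _ _ _ nAC nBC.symm, inv _ _ _ nBC nBC] }
    have hout : ∀ y, e.symm y wC = if y wA then y wB else y wC := by
      intro y
      change toffoliFun wA wB wC (toffoliFun wC wC wB y) wC = _
      cases kA : y wA <;> cases kB : y wB <;> cases kC : y wC <;>
        simp [toffoliFun, kA, kB, kC, nBC, nAB]
    have hnorm : ∀ y, ‖toffoliPhase wA wB wC y * Φ x (muxFun wA wB wC y)‖ ^ 2 = ‖Φ x (e y)‖ ^ 2 := by
      intro y
      have : ‖toffoliPhase wA wB wC y‖ = 1 := by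
        unfold toffoliPhase; split_ifs <;> simp
      rw [norm_mul, this, one_mul]
      rfl
    have hprod : ∀ (f : (A → Bool) → ℝ) (g : (B → Bool) → ℝ) (h : (C → Bool) → ℝ),
        ∑ y : A ⊕ (B ⊕ C) → Bool, f (fun a => y (Sum.inl a)) *
          (g (fun b => y (Sum.inr (Sum.inl b))) * h (fun c => y (Sum.inr (Sum.inr c)))) =
        (∑ a, f a) * ((∑ b, g b) * ∑ c, h c) := by
      intro f g h
      rw [← sum_arrow_sum g h, ← sum_arrow_sum f]
    simp only [hnorm]
    constructor
    · rw [← e.symm.sum_comp]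
      simp only [hout, Equiv.apply_symm_apply]
      have key : ∀ y : A ⊕ (B ⊕ C) → Bool,
          (if (if y wA then y wB else y wC) then ‖Φ x y‖ ^ 2 else 0) =
          (fun a => if a oA then ‖φA x a‖ ^ 2 else 0) (fun a => y (Sum.inl a)) *
            ((fun b => if b oB then ‖φB x b‖ ^ 2 else 0) (fun b => y (Sum.inr (Sum.inl b))) *
              (fun c => ‖φC x c‖ ^ 2) (fun c => y (Sum.inr (Sum.inr c)))) +
          (fun a => ‖φA x a‖ ^ 2 - if a oA then ‖φA x a‖ ^ 2 else 0) (fun a => y (Sum.inl a)) *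
            ((fun b => ‖φB x b‖ ^ 2) (fun b => y (Sum.inr (Sum.inl b))) *
              (fun c => if c oC then ‖φC x c‖ ^ 2 else 0) (fun c => y (Sum.inr (Sum.inr c)))) := by
        intro y
        change (if (if y (Sum.inl oA) then y (Sum.inr (Sum.inl oB)) else y (Sum.inr (Sum.inr oC)))
          then ‖Φ x y‖ ^ 2 else 0) = _
        cases kA : y (Sum.inl oA) <;> cases kB : y (Sum.inr (Sum.inl oB)) <;>
          cases kC : y (Sum.inr (Sum.inr oC)) <;> simp [kA, kB, kC, Φ] <;> ring
      rw [Finset.sum_congr rfl fun y _ => key y]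
      rw [Finset.sum_add_distrib,
        hprod (fun a => if a oA then ‖φA x a‖ ^ 2 else 0)
          (fun b => if b oB then ‖φB x b‖ ^ 2 else 0) (fun c => ‖φC x c‖ ^ 2),
        hprod (fun a => ‖φA x a‖ ^ 2 - if a oA then ‖φA x a‖ ^ 2 else 0)
          (fun b => ‖φB x b‖ ^ 2) (fun c => if c oC then ‖φC x c‖ ^ 2 else 0), Finset.sum_sub_distrib, (hA4 x).1, (hA4 x).2,
        (hB4 x).1, (hB4 x).2, (hC4 x).1, (hC4 x).2]
      ring
    · rw [e.sum_comp (fun y => ‖Φ x y‖ ^ 2)]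
      have := hprod (fun a => ‖φA x a‖ ^ 2) (fun b => ‖φB x b‖ ^ 2) (fun c => ‖φC x c‖ ^ 2)
      rw [(hA4 x).2, (hB4 x).2, (hC4 x).2] at this
      rw [← show (1 : ℝ) * (1 * 1) = 1 by norm_num, ← this]
      refine Finset.sum_congr rfl fun y _ => ?_
      simp only [Φ, norm_mul]
      ring

end Samples

/-! ### From sampling to amplitudes -/

/-- The gate `diag(-1, 1)`. -/
noncomputable def signMatrix : Matrix.unitaryGroup Bool ℂ :=
  ⟨Matrix.diagonal fun b => if b then 1 else -1, by
    rw [Matrix.mem_unitaryGroup_iff]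
    ext i j
    cases i <;> cases j <;> simp [Matrix.mul_apply, Matrix.star_apply, Matrix.diagonal_apply]⟩

theorem signMatrix_act {R : Type} [DecidableEq R] (q : R) (ψ : (R → Bool) → ℂ) (z : R → Bool) :
    (QGate.single q signMatrix).act ψ z = (if z q then 1 else -1) * ψ z := by
  have hu : Function.update z q (z q) = z := Function.update_eq_self _ _
  cases hq : z q <;> rw [hq] at hu <;> simp [QGate.act, signMatrix, hq, Matrix.diagonal_apply, hu]

theorem zeroState_sum (X A : Type) [Fintype X] [Fintype A] :
    zeroState (X ⊕ A) = adjoinZero A (zeroState X) := by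
  ext z
  have : z = (fun _ => false) ↔ (fun x => z (Sum.inl x)) = (fun _ => false) ∧
      (fun a => z (Sum.inr a)) = (fun _ => false) := by
    simp [funext_iff, Sum.forall]
  simp only [adjoinZero, zeroState_apply, this]
  split_ifs <;> simp_all

/-- A sampler for `p` can be run forwards, followed by a sign that depends on the output bit, and
backwards. The component of the result in which the ancillas have returned to `0` is the
original state with its amplitudes multiplied by `2 * p x - 1`. There is no other component when
the output bit is deterministic. -/
theorem Samples.exists_kickback {X : Type} [Fintype X] [DecidableEq X] {p : (X → Bool) → ℝ} {G : ℕ}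
    (h : Samples p G) :
    ∃ (A : Type) (_ : Fintype A) (_ : DecidableEq A) (c : List (QGate (X ⊕ A))),
      c.length ≤ 2 * G + 1 ∧ Fintype.card A ≤ G ∧
      (∀ ψ x, runCircuit c (adjoinZero A ψ) (Sum.elim x fun _ => false) =
        ((2 * p x - 1 : ℝ) : ℂ) * ψ x) ∧
      ((∀ x, p x = 0 ∨ p x = 1) →
        PreparesFibrewise c fun x a => ((2 * p x - 1 : ℝ) : ℂ) * zeroState A a) := by
  obtain ⟨A, i1, i2, c, o, φ, h1, h2, h3, h4⟩ := h
  refine ⟨A, i1, i2, c ++ (.single (Sum.inr o) signMatrix :: invCircuit c), ?_, h2, ?_, ?_⟩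
  · simp only [List.length_append, List.length_cons, length_invCircuit]
    omega
  · intro ψ x
    have hx : (Pi.single (Sum.elim x fun _ => false) 1 : (X ⊕ A → Bool) → ℂ) =
        adjoinZero A (Pi.single x 1) := by
      ext z
      have : z = (Sum.elim x fun _ => false) ↔ (fun y => z (Sum.inl y)) = x ∧
          (fun a => z (Sum.inr a)) = (fun _ => false) := by
        simp [funext_iff, Sum.forall]
      simp only [adjoinZero, zeroState_apply, Pi.single_apply, this]
      split_ifs <;> simp_all
    rw [runCircuit_append, runCircuit_cons, runCircuit_invCircuit_apply, hx, h3, h3]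
    simp only [signMatrix_act]
    have hs := sum_arrow_sum (A := X) (B := A) (fun y => if y = x then ψ x else 0)
      (fun a => if a o then ((‖φ x a‖ ^ 2 : ℝ) : ℂ) else -((‖φ x a‖ ^ 2 : ℝ) : ℂ))
    rw [Finset.sum_ite_eq' Finset.univ x (fun _ => ψ x), if_pos (Finset.mem_univ x)] at hs
    have hsum : ∑ a, (if a o then ((‖φ x a‖ ^ 2 : ℝ) : ℂ) else -((‖φ x a‖ ^ 2 : ℝ) : ℂ)) =
        ((2 * p x - 1 : ℝ) : ℂ) := by
      have e1 : ∀ a : A → Bool, (if a o then ((‖φ x a‖ ^ 2 : ℝ) : ℂ)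
          else -((‖φ x a‖ ^ 2 : ℝ) : ℂ)) =
          ((2 * (if a o then ‖φ x a‖ ^ 2 else 0) - ‖φ x a‖ ^ 2 : ℝ) : ℂ) := by
        intro a
        split_ifs <;> push_cast <;> ring
      rw [Finset.sum_congr rfl fun a _ => e1 a, ← Complex.ofReal_sum, Finset.sum_sub_distrib,
        ← Finset.mul_sum, (h4 x).1, (h4 x).2]
    rw [hsum] at hs
    rw [mul_comm, ← hs]
    refine Finset.sum_congr rfl fun z _ => ?_
    by_cases hz : (fun y => z (Sum.inl y)) = x
    · have hn : ∀ w : ℂ, ((‖w‖ ^ 2 : ℝ) : ℂ) = star w * w := by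
        intro w
        have := Complex.conj_mul' w
        push_cast
        simpa using this.symm
      rw [hz]
      simp only [Pi.single_eq_same, if_true, hn, one_mul]
      split_ifs <;> ring
    · simp [hz]
  · intro hp ψ
    rw [runCircuit_append, runCircuit_cons, h3]
    have hz : (QGate.single (Sum.inr o) signMatrix).act (fun z : X ⊕ A → Bool =>
        ψ (fun x => z (Sum.inl x)) * φ (fun x => z (Sum.inl x)) (fun a => z (Sum.inr a))) =
        runCircuit c (adjoinZero A fun x => ((2 * p x - 1 : ℝ) : ℂ) * ψ x) := by
      ext z
      rw [h3, signMatrix_act]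
      change _ = ((2 * p (fun x => z (Sum.inl x)) - 1 : ℝ) : ℂ) * _ * _
      set x : X → Bool := fun x => z (Sum.inl x)
      set a : A → Bool := fun a => z (Sum.inr a) with ha
      have hao : z (Sum.inr o) = a o := rfl
      rw [hao]
      rcases hp x with hx | hx
      · by_cases hb : a o
        · have h0 := (h4 x).1
          rw [hx, Finset.sum_eq_zero_iff_of_nonneg (by intro i _; split_ifs <;> positivity)] at h0
          have := h0 a (Finset.mem_univ _)
          rw [if_pos hb] at this
          have : φ x a = 0 := by simpa using this
          simp [this]
        · rw [if_neg hb, hx]; push_cast; ring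
      · by_cases hb : a o
        · rw [if_pos hb, hx]; push_cast; ring
        · have h0 : ∑ b, (‖φ x b‖ ^ 2 - if b o then ‖φ x b‖ ^ 2 else 0) = 0 := by
            rw [Finset.sum_sub_distrib, (h4 x).1, (h4 x).2, hx]; ring
          rw [Finset.sum_eq_zero_iff_of_nonneg (by
            intro i _; split_ifs <;> simp)] at h0
          have := h0 a (Finset.mem_univ _)
          rw [if_neg hb] at this
          have : φ x a = 0 := by simpa using this
          simp [this]
    rw [hz, runCircuit_invCircuit]
    ext z
    simp only [adjoinZero]
    ring

/-! ### Samplers for particular functions -/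

section Samplers

variable {X : Type} [DecidableEq X]

theorem Samples.not {p : (X → Bool) → ℝ} {G : ℕ} (h : Samples p G) :
    Samples (fun x => 1 - p x) (G + 10) := by
  have := h.ite (Samples.coin 0 le_rfl zero_le_one) (Samples.coin 1 zero_le_one le_rfl)
  convert this using 2
  ring

theorem Samples.mul {p q : (X → Bool) → ℝ} {G₁ G₂ : ℕ} (hp : Samples p G₁) (hq : Samples q G₂) :
    Samples (fun x => p x * q x) (G₁ + G₂ + 9) := by
  have := hp.ite hq (Samples.coin 0 le_rfl zero_le_one)
  convert this using 2
  ring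

theorem Samples.all_false (L : List X) :
    Samples (fun v : X → Bool => if ∀ q ∈ L, v q = false then 1 else 0) (10 * L.length + 1) := by
  induction L with
  | nil => simpa using Samples.coin (X := X) 1 zero_le_one le_rfl
  | cons q L ih =>
    have := (Samples.var q).ite (Samples.coin 0 le_rfl zero_le_one) ih
    refine (Samples.mono (G := 1 + 1 + (10 * L.length + 1) + 8) ?_ (by simp; omega))
    convert this using 2 with v
    cases h : v q <;> simp [h]

/-- Horner's scheme: a polynomial with nonnegative coefficients of sum at most `1` is sampled by
deciding, with the right probability, to stop with output `1` or to go on to the next power. -/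
theorem Samples.polynomial {y : (X → Bool) → ℝ} {G : ℕ} (hy : Samples y G) (D : ℕ) (w : ℕ → ℝ)
    (hw : ∀ k, 0 ≤ w k) (hs : ∑ k ∈ Finset.range (D + 1), w k ≤ 1) :
    Samples (fun x => ∑ k ∈ Finset.range (D + 1), w k * y x ^ k) (D * (G + 19) + 1) := by
  induction D generalizing w with
  | zero =>
    simp only [zero_add, Finset.sum_range_one] at hs
    simpa using Samples.coin (X := X) (w 0) (hw 0) hs
  | succ D ih =>
    rw [Finset.sum_range_succ'] at hs
    set t := ∑ k ∈ Finset.range (D + 1), w (k + 1) with ht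
    have ht0 : 0 ≤ t := Finset.sum_nonneg fun k _ => hw _
    have ih' := ih (fun k => w (k + 1) / (1 - w 0)) (fun k => div_nonneg (hw _) (by linarith)) (by
      rw [← Finset.sum_div, ← ht]
      exact div_le_one_of_le₀ (by linarith) (by linarith))
    have := (Samples.coin (X := X) (w 0) (hw 0) (by linarith)).ite
      (Samples.coin 1 zero_le_one le_rfl) (hy.mul ih')
    refine Samples.mono (G := 1 + 1 + (G + (D * (G + 19) + 1) + 9) + 8) ?_
      (by rw [Nat.succ_mul]; omega)
    convert this using 2 with x
    rw [Finset.sum_range_succ']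
    have hk : ∀ k ∈ Finset.range (D + 1), w (k + 1) * y x ^ (k + 1) =
        (1 - w 0) * (y x * (w (k + 1) / (1 - w 0) * y x ^ k)) := by
      intro k hk
      by_cases h0 : 1 - w 0 = 0
      · have : t = 0 := by linarith
        rw [ht, Finset.sum_eq_zero_iff_of_nonneg fun k _ => hw _] at this
        rw [this k hk]; simp
      · field_simp
        ring
    rw [Finset.sum_congr rfl hk, ← Finset.mul_sum, ← Finset.mul_sum]
    ring

/-- Comparison of the number with binary digits `x (w 0), …, x (w (m - 1))` with a uniformly
random number below `2 ^ m`. -/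
theorem Samples.binary (w : ℕ → X) (m : ℕ) :
    Samples (fun x : X → Bool =>
      (∑ i ∈ Finset.range m, if x (w i) then (2 : ℝ) ^ i else 0) / 2 ^ m) (10 * m + 1) := by
  induction m with
  | zero => simpa using Samples.coin (X := X) 0 le_rfl zero_le_one
  | succ m ih =>
    have := (Samples.coin (X := X) (1 / 2) (by norm_num) (by norm_num)).ite ih
      (Samples.var (w m))
    refine Samples.mono (G := 1 + (10 * m + 1) + 1 + 8) ?_ (by omega)
    convert this using 2 with x
    rw [Finset.sum_range_succ]
    split_ifs <;> field_simp <;> ring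

/-- A sampler for `1 - v ^ 2`, where `v ∈ [-1, 1)` is the number with binary expansion
`v = b₀ - 1 + ∑ i < m, bᵢ 2 ^ (i - m)` and `b₀` is the digit at `t`: the absolute value of `v` is
a probability, by comparison with a uniformly random number. -/
theorem Samples.one_sub_sq (w : ℕ → X) (m : ℕ) (t : X) :
    Samples (fun x : X → Bool => 1 - ((∑ i ∈ Finset.range m, if x (w i) then (2 : ℝ) ^ i else 0) /
      2 ^ m + (if x t then 0 else -1)) ^ 2) (40 * m + 61) := by
  have h := (Samples.var t).ite (Samples.binary w m) (Samples.binary w m).not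
  have := (h.mul h).not
  refine Samples.mono (G := (1 + (10 * m + 1) + (10 * m + 1 + 10) + 8 +
    (1 + (10 * m + 1) + (10 * m + 1 + 10) + 8) + 9) + 10) ?_ (by omega)
  convert this using 2 with x
  split_ifs <;> ring

end Samplers

/-! ### Amplitude amplification -/

theorem runCircuit_map_inl {X A : Type} [Fintype A] [DecidableEq X] [DecidableEq A]
    (c : List (QGate X)) (ψ : (X → Bool) → ℂ) :
    runCircuit (mapCircuit Sum.inl Sum.inl_injective c) (adjoinZero A ψ) =
      adjoinZero A (runCircuit c ψ) := by
  ext z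
  rw [runCircuit_mapCircuit_apply]
  have : slice Sum.inl z (adjoinZero A ψ) = zeroState A (fun a => z (Sum.inr a)) • ψ := by
    ext w
    have h1 : ∀ x, Function.extend Sum.inl w z (Sum.inl x : X ⊕ A) = w x := fun x =>
      Sum.inl_injective.extend_apply _ _ _
    have h2 : ∀ a, Function.extend Sum.inl w z (Sum.inr a : X ⊕ A) = z (Sum.inr a) := fun a =>
      Function.extend_apply' _ _ _ (by simp)
    simp [slice, adjoinZero, h1, mul_comm]
  rw [this, runCircuit_smul]
  simp [adjoinZero, mul_comm]

theorem PreparesFibrewise.run_map_of_zeroState {X A R : Type} [Fintype A] [Fintype R]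
    [DecidableEq X] [DecidableEq A] [DecidableEq R] {c : List (QGate (X ⊕ A))}
    {k : (X → Bool) → ℂ} (h : PreparesFibrewise c fun x a => k x * zeroState A a)
    (e : A → R) (he : Function.Injective e) (ψ : (X → Bool) → ℂ) :
    runCircuit (mapCircuit (Sum.map id e) (Function.injective_id.sumMap he) c) (adjoinZero R ψ) =
      adjoinZero R fun x => k x * ψ x := by
  classical
  -- the amplitude of the wires other than the ancillas of `c`
  let χ : (X ⊕ R → Bool) → ℂ := fun z => ψ (fun x => z (Sum.inl x)) *
    if ∀ r, (∀ a, e a ≠ r) → z (Sum.inr r) = false then 1 else 0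
  have hsplit : ∀ z : X ⊕ R → Bool, zeroState R (fun r => z (Sum.inr r)) =
      (if ∀ r, (∀ a, e a ≠ r) → z (Sum.inr r) = false then 1 else 0) *
        zeroState A (fun a => z (Sum.inr (e a))) := by
    intro z
    have : (fun r => z (Sum.inr r)) = (fun _ => false) ↔
        (∀ r, (∀ a, e a ≠ r) → z (Sum.inr r) = false) ∧
          (fun a => z (Sum.inr (e a))) = (fun _ => false) := by
      constructor
      · intro h
        exact ⟨fun r _ => congrFun h r, funext fun a => congrFun h (e a)⟩
      · rintro ⟨h1, h2⟩
        ext r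
        by_cases hr : ∃ a, e a = r
        · obtain ⟨a, rfl⟩ := hr
          exact congrFun h2 a
        · exact h1 r fun a ha => hr ⟨a, ha⟩
    simp only [zeroState_apply, this]
    split_ifs <;> simp_all
  have h0 : adjoinZero R ψ = fun z => χ z *
      zeroState A (fun a => z (Sum.map id e (Sum.inr a : X ⊕ A))) := by
    ext z
    simp only [adjoinZero, hsplit, χ, Sum.map_inr]
    ring
  rw [h0, h.run_map]
  · ext z
    simp only [adjoinZero, hsplit, χ, Sum.map_inr, Sum.map_inl, id]
    ring
  · intro z z' hz
    have z1 : ∀ x, z (Sum.inl x) = z' (Sum.inl x) := fun x => hz _ (by simp)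
    have z2 : (∀ r, (∀ a, e a ≠ r) → z (Sum.inr r) = false) ↔
        (∀ r, (∀ a, e a ≠ r) → z' (Sum.inr r) = false) := by
      refine forall_congr' fun r => forall_congr' fun hr => ?_
      rw [hz (Sum.inr r) (by simpa using hr)]
    simp only [χ, z1, z2]

theorem runCircuit_map_equiv_zeroState {Q R : Type} [Fintype Q] [DecidableEq Q] [Fintype R]
    [DecidableEq R] (e : Q ≃ R) (c : List (QGate Q)) :
    runCircuit (mapCircuit e e.injective c) (zeroState R) =
      fun z => runCircuit c (zeroState Q) fun q => z (e q) := by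
  ext z
  rw [runCircuit_mapCircuit_apply]
  congr 1
  ext w
  have : Function.extend e w z = (fun _ => false) ↔ w = fun _ => false := by
    constructor
    · intro h
      ext q
      rw [← e.injective.extend_apply w z q, h]
    · rintro rfl
      ext r
      rw [← e.apply_symm_apply r, e.injective.extend_apply]
  simp only [slice, zeroState_apply, this]

/-- Amplitude amplification. If the state `s` prepared by `U` has weight `sin² θ` on the
assignments satisfying `S`, then each round, a reflection in `S` followed by the reflection in
`s`, turns `s` by the angle `2θ` in the plane spanned by its two components. The reflections are
given as circuits on additional ancillas. -/
theorem exists_amplify {Q B B' : Type} [Fintype Q] [DecidableEq Q] [Fintype B] [DecidableEq B]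
    [Fintype B'] [DecidableEq B'] (U : List (QGate Q)) (S : (Q → Bool) → Prop) [DecidablePred S]
    (cS : List (QGate (Q ⊕ B)))
    (hS : PreparesFibrewise cS fun z b => (if S z then -1 else 1) * zeroState B b)
    (c₀ : List (QGate (Q ⊕ B')))
    (h₀ : PreparesFibrewise c₀ fun z b => (if z = fun _ => false then 1 else -1) * zeroState B' b)
    (θ : ℝ) (hsin : Real.sin θ ≠ 0) (hcos : Real.cos θ ≠ 0)
    (hθ : ∑ z, (if S z then ‖runCircuit U (zeroState Q) z‖ ^ 2 else 0) = Real.sin θ ^ 2) (r : ℕ) :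
    ∃ c : List (QGate (Q ⊕ (B ⊕ B'))),
      c.length = U.length + r * (2 * U.length + cS.length + c₀.length) ∧
      runCircuit c (zeroState (Q ⊕ (B ⊕ B'))) = adjoinZero (B ⊕ B') fun z =>
        ((if S z then Real.sin ((2 * r + 1) * θ) / Real.sin θ
          else Real.cos ((2 * r + 1) * θ) / Real.cos θ : ℝ) : ℂ) *
        runCircuit U (zeroState Q) z := by
  set s := runCircuit U (zeroState Q) with hs
  have hs1 : ∑ z, ‖s z‖ ^ 2 = 1 := by
    rw [hs, runCircuit_isometry, Finset.sum_eq_single fun _ => false]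
    · simp [zeroState_apply]
    · intro z _ hz
      simp [zeroState_apply, hz]
    · simp
  induction r with
  | zero =>
    refine ⟨mapCircuit Sum.inl Sum.inl_injective U, by simp [length_mapCircuit], ?_⟩
    rw [zeroState_sum, runCircuit_map_inl, ← hs]
    congr 1
    ext z
    simp [div_self hsin, div_self hcos]
  | succ r ih =>
    obtain ⟨c, hc1, hc2⟩ := ih
    refine ⟨c ++ (mapCircuit (Sum.map id Sum.inl)
        (Function.injective_id.sumMap Sum.inl_injective) cS ++
      (mapCircuit Sum.inl Sum.inl_injective (invCircuit U) ++
        (mapCircuit (Sum.map id Sum.inr) (Function.injective_id.sumMap Sum.inr_injective) c₀ ++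
          mapCircuit Sum.inl Sum.inl_injective U))), ?_, ?_⟩
    · simp only [List.length_append, length_mapCircuit, length_invCircuit, hc1]
      ring
    rw [runCircuit_append, hc2, runCircuit_append, hS.run_map_of_zeroState _ Sum.inl_injective,
      runCircuit_append, runCircuit_map_inl, runCircuit_append,
      h₀.run_map_of_zeroState _ Sum.inr_injective, runCircuit_map_inl]
    congr 1
    set α : ℝ := Real.sin ((2 * r + 1) * θ) / Real.sin θ with hα
    set γ : ℝ := Real.cos ((2 * r + 1) * θ) / Real.cos θ with hγ
    set v : (Q → Bool) → ℂ := fun z => (if S z then -1 else 1) *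
      (((if S z then α else γ : ℝ) : ℂ) * s z) with hv
    -- the reflection in the zero state, and hence the one in `s`, as a rank one perturbation
    have hrefl : (fun z => (if z = fun _ => false then 1 else -1) * runCircuit (invCircuit U) v z) =
        (2 * runCircuit (invCircuit U) v (fun _ => false)) • zeroState Q +
          (-1 : ℂ) • runCircuit (invCircuit U) v := by
      ext z
      by_cases hz : z = fun _ => false
      · simp [hz, zeroState_apply]; ring
      · simp [hz, zeroState_apply]
    have hinner : runCircuit (invCircuit U) v (fun _ => false) =
        ((γ * Real.cos θ ^ 2 - α * Real.sin θ ^ 2 : ℝ) : ℂ) := by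
      rw [runCircuit_invCircuit_apply]
      have hsingle : (Pi.single (fun _ => false) 1 : (Q → Bool) → ℂ) = zeroState Q := by
        ext z; simp [zeroState_apply, Pi.single_apply]
      rw [hsingle, ← hs]
      have hn : ∀ w : ℂ, star w * w = ((‖w‖ ^ 2 : ℝ) : ℂ) := by
        intro w
        have := Complex.conj_mul' w
        push_cast
        simpa using this
      have hterm : ∀ z, star (s z) * v z =
          ((γ * ‖s z‖ ^ 2 - (γ + α) * (if S z then ‖s z‖ ^ 2 else 0) : ℝ) : ℂ) := by
        intro z
        have : star (s z) * v z = (if S z then -1 else 1) *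
            ((if S z then α else γ : ℝ) : ℂ) * (star (s z) * s z) := by
          simp only [hv]; ring
        rw [this, hn]
        split_ifs <;> push_cast <;> ring
      rw [Finset.sum_congr rfl fun z _ => hterm z, ← Complex.ofReal_sum, Finset.sum_sub_distrib,
        ← Finset.mul_sum, ← Finset.mul_sum, hs1, hθ, Real.cos_sq']
      congr 1
      ring
    rw [hrefl, runCircuit_add, runCircuit_smul, runCircuit_smul,
      runCircuit_runCircuit_invCircuit, ← hs, hinner]
    ext z
    have hang : (2 * ((r + 1 : ℕ) : ℝ) + 1) * θ = (2 * r + 1) * θ + 2 * θ := by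
      push_cast; ring
    have e1 : Real.sin ((2 * ((r + 1 : ℕ) : ℝ) + 1) * θ) / Real.sin θ =
        2 * (γ * Real.cos θ ^ 2 - α * Real.sin θ ^ 2) + α := by
      rw [hang, Real.sin_add, Real.sin_two_mul, Real.cos_two_mul, hα, hγ]
      have := Real.sin_sq_add_cos_sq θ
      field_simp
      linear_combination (2 * Real.sin ((2 * r + 1) * θ)) * this
    have e2 : Real.cos ((2 * ((r + 1 : ℕ) : ℝ) + 1) * θ) / Real.cos θ =
        2 * (γ * Real.cos θ ^ 2 - α * Real.sin θ ^ 2) - γ := by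
      rw [hang, Real.cos_add, Real.sin_two_mul, Real.cos_two_mul, hα, hγ]
      field_simp
      ring
    rw [e1, e2]
    simp only [Pi.add_apply, Pi.smul_apply, smul_eq_mul, hv]
    split_ifs <;> push_cast <;> ring

/-- If `P` prepares a state with amplitudes `u x` and `g` can be sampled by `G` gates, then the
normalization of the state with amplitudes `u x * g x` can be prepared exactly, with a number of
gates inversely proportional to the norm `a` of the latter state. The angle of the rotation is
matched to the number of rounds by scaling `g`. -/
theorem exists_circuit_mul {X : Type} [Fintype X] [DecidableEq X] (P : List (QGate X))
    (g : (X → Bool) → ℝ) {G : ℕ} (hg : Samples g G) (a : ℝ) (ha0 : 0 < a) (ha1 : a ≤ 1)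
    (ha : ∑ x, ‖runCircuit P (zeroState X) x‖ ^ 2 * g x ^ 2 = a ^ 2) :
    ∃ (A : Type) (_ : Fintype A) (_ : DecidableEq A) (c : List (QGate (X ⊕ A))),
      (c.length : ℝ) ≤ 3000 * ((P.length + G + Fintype.card X + 1) / a) ∧
      runCircuit c (zeroState (X ⊕ A)) =
        adjoinZero A fun x => ((g x / a : ℝ) : ℂ) * runCircuit P (zeroState X) x := by
  set u := runCircuit P (zeroState X) with hu
  obtain ⟨r, hr⟩ : ∃ r : ℕ, r = ⌈1 / a⌉₊ := ⟨_, rfl⟩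
  have hr1 : 1 / a ≤ r := hr ▸ Nat.le_ceil _
  have hr2 : (r : ℝ) ≤ 1 / a + 1 := hr ▸ (Nat.ceil_lt_add_one (by positivity)).le
  have h1a : 1 ≤ 1 / a := by rw [le_div_iff₀ ha0]; linarith
  set θ : ℝ := Real.pi / (2 * (2 * r + 1)) with hθ
  have hpi := Real.pi_pos
  have hθ0 : 0 < θ := by positivity
  have hθ1 : θ < Real.pi / 2 := by
    rw [hθ, div_lt_div_iff_of_pos_left hpi (by positivity) (by norm_num)]
    linarith
  have hsin : 0 < Real.sin θ := Real.sin_pos_of_pos_of_lt_pi hθ0 (by linarith)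
  have hcos : 0 < Real.cos θ := Real.cos_pos_of_mem_Ioo ⟨by linarith, hθ1⟩
  have hsa : Real.sin θ ≤ a := by
    refine (Real.sin_le hθ0.le).trans ?_
    rw [hθ, div_le_iff₀ (by positivity)]
    have : 1 ≤ r * a := by rwa [div_le_iff₀ ha0] at hr1
    nlinarith [Real.pi_lt_four]
  have hl1 : Real.sin θ / a ≤ 1 := div_le_one_of_le₀ hsa ha0.le
  have hp : Samples (fun x => 1 / 2 * 1 + (1 - 1 / 2) * (Real.sin θ / a * g x)) (G + 20) := by
    refine ((Samples.coin (1 / 2) (by norm_num) (by norm_num)).ite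
      (Samples.coin 1 zero_le_one le_rfl)
      ((Samples.coin _ (by positivity) hl1).mul hg)).mono (by omega)
  obtain ⟨A, i1, i2, cA, hA1, hA2, hA3, -⟩ := hp.exists_kickback
  set U := mapCircuit Sum.inl Sum.inl_injective P ++ cA with hU
  have hs : ∀ x, runCircuit U (zeroState (X ⊕ A)) (Sum.elim x fun _ => false) =
      ((Real.sin θ / a * g x : ℝ) : ℂ) * u x := by
    intro x
    rw [hU, runCircuit_append, zeroState_sum, runCircuit_map_inl, hA3, ← hu]
    congr 2
    ring
  let S : (X ⊕ A → Bool) → Prop := fun z => ∀ a, z (Sum.inr a) = false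
  let LA : List (X ⊕ A) := Finset.univ.toList.map Sum.inr
  let LQ : List (X ⊕ A) := Finset.univ.toList
  have hLA : LA.length = Fintype.card A := by simp [LA]
  have hLQ : LQ.length = Fintype.card X + Fintype.card A := by simp [LQ]
  obtain ⟨B, i3, i4, cB, hB1, -, -, hB3⟩ := (Samples.all_false LA).not.exists_kickback
  obtain ⟨B', i5, i6, cB', hB1', -, -, hB3'⟩ := (Samples.all_false LQ).exists_kickback
  have hS : PreparesFibrewise cB fun z b => (if S z then -1 else 1) * zeroState B b := by
    convert hB3 (fun z => by split_ifs <;> simp) using 4 with z b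
    have : (∀ q ∈ LA, z q = false) ↔ S z := by simp [LA, S]
    simp only [this]
    split_ifs <;> norm_num
  have hS' : PreparesFibrewise cB' fun z b =>
      (if z = fun _ => false then 1 else -1) * zeroState B' b := by
    convert hB3' (fun z => by split_ifs <;> simp) using 4 with z b
    have : (∀ q ∈ LQ, z q = false) ↔ z = fun _ => false := by
      simp only [LQ, Finset.mem_toList, Finset.mem_univ, true_imp_iff]
      exact ⟨fun h => funext h, fun h q => congrFun h q⟩
    simp only [this]
    split_ifs <;> norm_num
  have hweight : ∑ z, (if S z then ‖runCircuit U (zeroState (X ⊕ A)) z‖ ^ 2 else 0) =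
      Real.sin θ ^ 2 := by
    have h1 := sum_arrow_sum (A := X) (B := A) (fun x => (Real.sin θ / a) ^ 2 *
      (‖u x‖ ^ 2 * g x ^ 2)) (fun b => if b = (fun _ => false) then 1 else 0)
    rw [Finset.sum_ite_eq' Finset.univ, if_pos (Finset.mem_univ _), ← Finset.mul_sum, ha] at h1
    have h2 : (Real.sin θ / a) ^ 2 * a ^ 2 * 1 = Real.sin θ ^ 2 := by field_simp
    rw [← h2, ← h1]
    refine Finset.sum_congr rfl fun z _ => ?_
    by_cases hz : S z
    · have hz' : (fun b => z (Sum.inr b)) = fun _ => false := funext hz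
      have : z = Sum.elim (fun x => z (Sum.inl x)) fun _ => false := by
        ext q
        cases q with
        | inl x => rfl
        | inr b => exact hz b
      rw [if_pos hz, if_pos hz', this, hs]
      simp only [norm_mul, Complex.norm_real, Real.norm_eq_abs, mul_pow, sq_abs, Sum.elim_inl]
      ring
    · rw [if_neg hz, if_neg fun h => hz fun b => congrFun h b]
      simp
  obtain ⟨c, hc1, hc2⟩ := exists_amplify U S cB hS cB' hS' θ hsin.ne' hcos.ne' hweight r
  refine ⟨A ⊕ (B ⊕ B'), inferInstance, inferInstance, mapCircuit (Equiv.sumAssoc X A (B ⊕ B'))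
    (Equiv.injective _) c, ?_, ?_⟩
  · rw [length_mapCircuit, hc1]
    have hUl : U.length ≤ P.length + (2 * (G + 20) + 1) := by
      simp only [hU, List.length_append, length_mapCircuit]
      omega
    have hN : (2 * U.length + cB.length + cB'.length : ℝ) ≤
        1000 * (P.length + G + Fintype.card X + 1 : ℝ) := by
      have : 2 * U.length + cB.length + cB'.length ≤
          1000 * (P.length + G + Fintype.card X + 1) := by
        rw [hLA] at hB1
        rw [hLQ] at hB1'
        omega
      exact_mod_cast this
    set M : ℝ := P.length + G + Fintype.card X + 1 with hM
    have hM0 : 0 ≤ M := by positivity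
    have hU0 : (U.length : ℝ) ≤ 1000 * M := by
      have : (0 : ℝ) ≤ U.length + cB.length + cB'.length := by positivity
      linarith
    push_cast
    calc (U.length : ℝ) + r * (2 * U.length + cB.length + cB'.length)
        ≤ 1000 * M + (1 / a + 1) * (1000 * M) := by gcongr
      _ = 1000 * M * (1 / a + 1 + 1) := by ring
      _ ≤ 1000 * M * (3 * (1 / a)) := by gcongr; linarith
      _ = 3000 * (M / a) := by ring
  · rw [runCircuit_map_equiv_zeroState, hc2]
    ext z
    set z' : X ⊕ A → Bool := fun q => z (Sum.map id Sum.inl q) with hz'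
    have hx : (fun x => z' (Sum.inl x)) = fun x => z (Sum.inl x) := rfl
    have hzero : zeroState (A ⊕ (B ⊕ B')) (fun b => z (Sum.inr b)) =
        (if S z' then 1 else 0) * zeroState (B ⊕ B') (fun b => z (Sum.inr (Sum.inr b))) := by
      rw [zeroState_sum]
      simp only [adjoinZero, zeroState_apply, funext_iff, S, hz', Sum.map_inr]
    change ((if S z' then Real.sin ((2 * r + 1) * θ) / Real.sin θ
      else Real.cos ((2 * r + 1) * θ) / Real.cos θ : ℝ) : ℂ) *
        runCircuit U (zeroState (X ⊕ A)) z' * zeroState (B ⊕ B') (fun b => z (Sum.inr (Sum.inr b))) =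
      ((g (fun x => z (Sum.inl x)) / a : ℝ) : ℂ) * u (fun x => z (Sum.inl x)) *
        zeroState (A ⊕ (B ⊕ B')) (fun b => z (Sum.inr b))
    have hang : (2 * (r : ℝ) + 1) * θ = Real.pi / 2 := by
      rw [hθ]; field_simp
    rw [hzero, hang, Real.sin_pi_div_two, Real.cos_pi_div_two]
    by_cases h : S z'
    · have hzz : z' = Sum.elim (fun x => z (Sum.inl x)) fun _ => false := by
        ext q
        cases q with
        | inl x => rfl
        | inr b => exact h b
      rw [if_pos h, if_pos h, hzz, hs]
      have : ((1 / Real.sin θ : ℝ) : ℂ) * ((Real.sin θ / a * g (fun x => z (Sum.inl x)) : ℝ) : ℂ) =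
          ((g (fun x => z (Sum.inl x)) / a : ℝ) : ℂ) := by
        rw [← Complex.ofReal_mul]
        congr 1
        field_simp
      rw [← mul_assoc, this]
      ring
    · rw [if_neg h, if_neg h]
      simp

/-! ### The trace distance of pure states -/

open scoped InnerProductSpace in
/-- The trace distance of two pure states is at most their distance as vectors: in an eigenbasis
`v` of `|ψ⟩⟨ψ| - |χ⟩⟨χ|`, each eigenvalue is
`⟨v, ψ - χ⟩⟨ψ, v⟩ + ⟨v, χ⟩⟨ψ - χ, v⟩`, and the sum is estimated by Cauchy–Schwarz. -/
theorem traceDistance_pureDensity_le {ι : Type} [Fintype ι] [DecidableEq ι] (ψ χ : ι → ℂ)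
    (hψ : ∑ i, ‖ψ i‖ ^ 2 = 1) (hχ : ∑ i, ‖χ i‖ ^ 2 = 1) :
    traceDistance (pureDensity_isHermitian ψ) (pureDensity_isHermitian χ) ≤
      √(∑ i, ‖ψ i - χ i‖ ^ 2) := by
  unfold traceDistance
  set hM := (pureDensity_isHermitian ψ).sub (pureDensity_isHermitian χ) with hMdef
  set b := hM.eigenvectorBasis with hb
  let p : EuclideanSpace ℂ ι := WithLp.toLp 2 ψ
  let q : EuclideanSpace ℂ ι := WithLp.toLp 2 χ
  have hp : ‖p‖ = 1 := by rw [EuclideanSpace.norm_eq]; simp [p, hψ]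
  have hq : ‖q‖ = 1 := by rw [EuclideanSpace.norm_eq]; simp [q, hχ]
  have hd : ‖p - q‖ = √(∑ i, ‖ψ i - χ i‖ ^ 2) := by rw [EuclideanSpace.norm_eq]; simp [p, q]
  have heig : ∀ i, (hM.eigenvalues i : ℂ) =
      ⟪b i, p - q⟫_ℂ * ⟪p, b i⟫_ℂ + ⟪b i, q⟫_ℂ * ⟪p - q, b i⟫_ℂ := by
    intro i
    have h1 : (pureDensity ψ - pureDensity χ).mulVec (b i) = hM.eigenvalues i • (b i : ι → ℂ) :=
      hM.mulVec_eigenvectorBasis i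
    have h2 : (pureDensity ψ - pureDensity χ).mulVec (b i) =
        fun j => ψ j * ⟪p, b i⟫_ℂ - χ j * ⟪q, b i⟫_ℂ := by
      ext j
      simp only [Matrix.mulVec, dotProduct, Matrix.sub_apply, pureDensity, Matrix.vecMulVec_apply,
        PiLp.inner_apply, p, q, Finset.mul_sum, ← Finset.sum_sub_distrib]
      refine Finset.sum_congr rfl fun k _ => ?_
      simp
      ring
    have h3 : (hM.eigenvalues i : ℂ) • b i = ⟪p, b i⟫_ℂ • p - ⟪q, b i⟫_ℂ • q := by
      ext j
      have := congrFun (h1.symm.trans h2) j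
      simp [p, q] at this ⊢
      rw [this]; ring
    have h4 := congrArg (fun v => ⟪b i, v⟫_ℂ) h3
    simp only [inner_smul_right, inner_sub_right] at h4
    rw [inner_self_eq_norm_sq_to_K, b.orthonormal.1 i] at h4
    simp only [inner_sub_left, inner_sub_right]
    simp at h4
    rw [h4]
    ring
  have hle : ∀ i, |hM.eigenvalues i| ≤ ‖⟪b i, p - q⟫_ℂ‖ * ‖⟪b i, p⟫_ℂ‖ +
      ‖⟪b i, q⟫_ℂ‖ * ‖⟪b i, p - q⟫_ℂ‖ := by
    intro i
    rw [← Real.norm_eq_abs, ← Complex.norm_real, heig]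
    refine (norm_add_le _ _).trans ?_
    rw [norm_mul, norm_mul, norm_inner_symm p, norm_inner_symm (p - q)]
  have hpars : ∀ v : EuclideanSpace ℂ ι, √(∑ i, ‖⟪b i, v⟫_ℂ‖ ^ 2) = ‖v‖ := by
    intro v
    rw [b.sum_sq_norm_inner_right, Real.sqrt_sq (norm_nonneg _)]
  have hcs : ∀ v w : EuclideanSpace ℂ ι, ∑ i, ‖⟪b i, v⟫_ℂ‖ * ‖⟪b i, w⟫_ℂ‖ ≤ ‖v‖ * ‖w‖ := by
    intro v w
    rw [← hpars v, ← hpars w]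
    exact Real.sum_mul_le_sqrt_mul_sqrt _ _ _
  calc 1 / 2 * ∑ i, |hM.eigenvalues i|
      ≤ 1 / 2 * ∑ i, (‖⟪b i, p - q⟫_ℂ‖ * ‖⟪b i, p⟫_ℂ‖ + ‖⟪b i, q⟫_ℂ‖ * ‖⟪b i, p - q⟫_ℂ‖) := by
        gcongr with i; exact hle i
    _ ≤ 1 / 2 * (‖p - q‖ * ‖p‖ + ‖q‖ * ‖p - q‖) := by
        rw [Finset.sum_add_distrib]
        gcongr
        · exact hcs _ _
        · exact hcs _ _
    _ = √(∑ i, ‖ψ i - χ i‖ ^ 2) := by rw [hp, hq, hd]; ring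

theorem sum_norm_sq_adjoinZero {X A : Type} [Fintype X] [DecidableEq X] [Fintype A]
    [DecidableEq A] (ψ : (X → Bool) → ℂ) :
    ∑ z, ‖adjoinZero A ψ z‖ ^ 2 = ∑ x, ‖ψ x‖ ^ 2 := by
  have h := sum_arrow_sum (A := X) (B := A) (fun x => ‖ψ x‖ ^ 2) (fun a => ‖zeroState A a‖ ^ 2)
  have h1 : ∑ a, ‖zeroState A a‖ ^ 2 = 1 := by
    rw [Finset.sum_eq_single fun _ => false]
    · simp [zeroState_apply]
    · intro z _ hz
      simp [zeroState_apply, hz]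
    · simp
  rw [h1, mul_one] at h
  rw [← h]
  simp only [adjoinZero, norm_mul, mul_pow]

/-- A state is prepared up to the distance of a state that is prepared exactly. -/
theorem canPrepare_of_runCircuit {n : ℕ} {A : Type} [Fintype A] [DecidableEq A]
    (c : List (QGate (Fin n ⊕ A))) (ψ Ψ : (Fin n → Bool) → ℂ)
    (hc : runCircuit c (zeroState (Fin n ⊕ A)) = adjoinZero A ψ)
    (hΨ : ∑ x, ‖Ψ x‖ ^ 2 = 1) {ε G : ℝ} (hε : √(∑ x, ‖ψ x - Ψ x‖ ^ 2) ≤ ε)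
    (hG : (c.length : ℝ) ≤ G) : CanPrepare Ψ ε G := by
  let e : Fin n ⊕ A ≃ Fin n ⊕ Fin (Fintype.card A) :=
    Equiv.sumCongr (Equiv.refl _) (Fintype.equivFin A)
  have hrun : runCircuit (mapCircuit e e.injective c) (zeroState (Fin n ⊕ Fin (Fintype.card A))) =
      adjoinZero (Fin (Fintype.card A)) ψ := by
    rw [runCircuit_map_equiv_zeroState, hc]
    ext z
    have : (fun a => z (e (Sum.inr a))) = (fun _ => false) ↔
        (fun a => z (Sum.inr a)) = (fun _ => false) := by
      constructor
      · intro h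
        ext a
        have := congrFun h ((Fintype.equivFin A).symm a)
        simpa [e] using this
      · intro h
        ext a
        exact congrFun h _
    simp only [adjoinZero, zeroState_apply, this]
    rfl
  have hψ : ∑ x, ‖ψ x‖ ^ 2 = 1 := by
    rw [← sum_norm_sq_adjoinZero (A := A), ← hc, runCircuit_isometry,
      Finset.sum_eq_single fun _ => false]
    · simp [zeroState_apply]
    · intro z _ hz
      simp [zeroState_apply, hz]
    · simp
  refine ⟨Fintype.card A, mapCircuit e e.injective c, by rwa [length_mapCircuit], ?_⟩
  have hΨ' : withZeroAncillas Ψ (Fintype.card A) = adjoinZero (Fin (Fintype.card A)) Ψ := rfl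
  refine (traceDistance_pureDensity_le _ _ ?_ ?_).trans (le_trans (le_of_eq ?_) hε)
  · rw [hrun, sum_norm_sq_adjoinZero, hψ]
  · rw [hΨ', sum_norm_sq_adjoinZero, hΨ]
  · rw [hrun, hΨ', ← sum_norm_sq_adjoinZero (A := Fin (Fintype.card A)) (fun x => ψ x - Ψ x)]
    congr 1
    refine Finset.sum_congr rfl fun z _ => ?_
    simp only [adjoinZero, sub_mul]

/-! ### Uniform superpositions over a window of grid points -/

section Window

variable {X : Type} [DecidableEq X]

theorem exists_uniform_circuit [Fintype X] (S : Finset X) :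
    ∃ c : List (QGate X), c.length = S.card ∧ runCircuit c (zeroState X) =
      fun z => if ∀ q, q ∉ S → z q = false then ((√(1 / 2) ^ S.card : ℝ) : ℂ) else 0 := by
  induction S using Finset.induction_on with
  | empty =>
    refine ⟨[], rfl, ?_⟩
    ext z
    simp [runCircuit_nil, zeroState_apply, funext_iff]
  | insert q S hq ih =>
    obtain ⟨c, h1, h2⟩ := ih
    have hh : √(1 / 2) ^ 2 + √(1 / 2) ^ 2 = 1 := by
      rw [Real.sq_sqrt (by norm_num)]; norm_num
    refine ⟨c ++ [.single q (realRotation √(1 / 2) √(1 / 2) hh)], ?_, ?_⟩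
    · simp [h1, hq]
    · rw [runCircuit_append, h2, runCircuit_cons, runCircuit_nil]
      ext z
      have ht : ¬ ∀ q', q' ∉ S → Function.update z q true q' = false := by
        intro h
        simpa using h q hq
      have hf : (∀ q', q' ∉ S → Function.update z q false q' = false) ↔
          ∀ q', q' ∉ insert q S → z q' = false := by
        refine forall_congr' fun q' => ?_
        by_cases hqq : q' = q
        · subst hqq; simp
        · simp [hqq]
      rw [realRotation_act, if_neg ht, Finset.card_insert_of_notMem hq]
      simp only [hf]
      split_ifs <;> push_cast <;> ring

/-- The NOT gate. -/
noncomputable def notMatrix : Matrix.unitaryGroup Bool ℂ :=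
  ⟨Matrix.of fun i j => if i = j then 0 else 1, by
    rw [Matrix.mem_unitaryGroup_iff]
    ext i j
    cases i <;> cases j <;> simp [Matrix.mul_apply, Matrix.star_apply]⟩

theorem notMatrix_act (q : X) (ψ : (X → Bool) → ℂ) (z : X → Bool) :
    (QGate.single q notMatrix).act ψ z = ψ (Function.update z q (!(z q))) := by
  cases hq : z q <;> simp [QGate.act, notMatrix, hq]

theorem exists_copy_not_circuit (t : X) (T : Finset X) (ht : t ∉ T) :
    ∃ c : List (QGate X), c.length = 2 * T.card ∧ ∀ ψ, runCircuit c ψ =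
      fun z => ψ fun q => if q ∈ T then !(xor (z q) (z t)) else z q := by
  induction T using Finset.induction_on with
  | empty => exact ⟨[], rfl, fun ψ => by simp [runCircuit_nil]⟩
  | insert q T hq ih =>
    have htq : t ≠ q := fun h => ht (by simp [h])
    obtain ⟨c, h1, h2⟩ := ih fun h => ht (Finset.mem_insert_of_mem h)
    refine ⟨c ++ [.single q notMatrix, .cnot t q htq], ?_, fun ψ => ?_⟩
    · simp [h1, hq]; ring
    · rw [runCircuit_append, h2, runCircuit_cons, runCircuit_cons, runCircuit_nil]
      ext z
      rw [cnot_act, notMatrix_act]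
      congr 1
      ext q'
      by_cases hqq : q' = q
      · subst hqq
        cases hz : z t <;> cases hz' : z q' <;> simp [hq, hz']
      · by_cases hT : q' ∈ T <;> cases hz : z t <;>
          simp [hqq, hT, hz, Function.update_of_ne htq]

/-- The uniform superposition of the bit strings in which the bits in `T` are opposite to the bit
`t`. -/
theorem exists_window_circuit [Fintype X] (t : X) (T : Finset X) (ht : t ∉ T) :
    ∃ c : List (QGate X), c.length ≤ 2 * Fintype.card X ∧ runCircuit c (zeroState X) =
      fun z => if ∀ q ∈ T, z q = !(z t) then
        ((√(1 / 2) ^ (Fintype.card X - T.card) : ℝ) : ℂ) else 0 := by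
  obtain ⟨c, h1, h2⟩ := exists_uniform_circuit Tᶜ
  obtain ⟨d, h3, h4⟩ := exists_copy_not_circuit t T ht
  refine ⟨c ++ d, ?_, ?_⟩
  · rw [List.length_append, h1, h3, Finset.card_compl]
    have := Finset.card_le_univ T
    omega
  · rw [runCircuit_append, h2, h4, Finset.card_compl]
    ext z
    have : (∀ q, q ∉ Tᶜ → (if q ∈ T then !(xor (z q) (z t)) else z q) = false) ↔
        ∀ q ∈ T, z q = !(z t) := by
      refine forall_congr' fun q => ?_
      by_cases hq : q ∈ T
      · cases z q <;> cases z t <;> simp [hq]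
      · simp [hq]
    simp only [this]

end Window

theorem sum_bitsToNat {M : Type} [AddCommMonoid M] (n : ℕ) (F : ℕ → M) :
    ∑ x : Fin n → Bool, F (bitsToNat x) = ∑ k ∈ Finset.range (2 ^ n), F k := by
  induction n generalizing F with
  | zero => simp [bitsToNat]
  | succ n ih =>
    rw [← (Fin.snocEquiv fun _ => Bool).sum_comp, Fintype.sum_prod_type, Fintype.sum_bool,
      pow_succ, mul_two, Finset.sum_range_add, add_comm]
    have h0 : ∀ x : Fin n → Bool,
        bitsToNat ((Fin.snocEquiv fun _ => Bool) (false, x)) = bitsToNat x := by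
      intro x
      simp [bitsToNat, Fin.sum_univ_castSucc, Fin.snocEquiv]
    have h1 : ∀ x : Fin n → Bool,
        bitsToNat ((Fin.snocEquiv fun _ => Bool) (true, x)) = 2 ^ n + bitsToNat x := by
      intro x
      simp [bitsToNat, Fin.sum_univ_castSucc, Fin.snocEquiv, add_comm]
    simp only [h0, h1]
    rw [ih F, ih fun k => F (2 ^ n + k)]

/-- The qubit with label `i`, for `i < m + j + 1`. -/
def wire (m j i : ℕ) : Fin (m + j + 1) := Fin.ofNat (m + j + 1) i

theorem wire_inj {m j i i' : ℕ} (hi : i < m + j + 1) (hi' : i' < m + j + 1)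
    (h : wire m j i = wire m j i') : i = i' := by
  have := congrArg Fin.val h
  simpa [wire, Nat.mod_eq_of_lt hi, Nat.mod_eq_of_lt hi'] using this

/-- The bit strings of the grid points in the window `[-2⁻ʲ, 2⁻ʲ)`: the `j` digits following the
leading digit are opposite to it. -/
def InWindow (m j : ℕ) (x : Fin (m + j + 1) → Bool) : Prop :=
  ∀ i ∈ Finset.Ico m (m + j), x (wire m j i) = !(x (wire m j (m + j)))

/-- The position of a grid point of the window `[-2⁻ʲ, 2⁻ʲ)`, rescaled to `[-1, 1)`. -/
noncomputable def windowPoint (m j : ℕ) (x : Fin (m + j + 1) → Bool) : ℝ :=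
  (∑ i ∈ Finset.range m, if x (wire m j i) then (2 : ℝ) ^ i else 0) / 2 ^ m +
    if x (wire m j (m + j)) then 0 else -1

section Digits

variable {m j : ℕ} (x : Fin (m + j + 1) → Bool)

theorem bitsToNat_eq_sum : (bitsToNat x : ℝ) =
    ∑ i ∈ Finset.range m, (if x (wire m j i) then (2 : ℝ) ^ i else 0) +
    ∑ i ∈ Finset.Ico m (m + j), (if x (wire m j i) then (2 : ℝ) ^ i else 0) +
    if x (wire m j (m + j)) then (2 : ℝ) ^ (m + j) else 0 := by
  rw [Finset.sum_range_add_sum_Ico _ (by omega), ← Finset.sum_range_succ]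
  rw [← Fin.sum_univ_eq_sum_range (fun i => if x (wire m j i) then (2 : ℝ) ^ i else 0)]
  simp [bitsToNat, wire]

theorem sum_two_pow_Ico : ∑ i ∈ Finset.Ico m (m + j), (2 : ℝ) ^ i = 2 ^ (m + j) - 2 ^ m := by
  have h := geom_sum_Ico (x := (2 : ℝ)) (by norm_num) (show m ≤ m + j by omega)
  rw [h]; norm_num

theorem gridPoint_eq (k : ℝ) (hk : (bitsToNat x : ℝ) = 2 ^ (m + j) + k) :
    gridPoint (-1) 1 (m + j + 1) (bitsToNat x) * 2 ^ j = k / 2 ^ m := by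
  rw [gridPoint, hk]
  simp only [pow_add, pow_one]
  field_simp
  ring

theorem InWindow.gridPoint_eq (h : InWindow m j x) :
    gridPoint (-1) 1 (m + j + 1) (bitsToNat x) * 2 ^ j = windowPoint m j x := by
  by_cases ht : x (wire m j (m + j))
  · have h0 : ∑ i ∈ Finset.Ico m (m + j), (if x (wire m j i) then (2 : ℝ) ^ i else 0) = 0 :=
      Finset.sum_eq_zero fun i hi => by simp [h i hi, ht]
    rw [_root_.gridPoint_eq x (∑ i ∈ Finset.range m, if x (wire m j i) then (2 : ℝ) ^ i else 0)]
    · simp [windowPoint, ht]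
    · rw [bitsToNat_eq_sum, h0, if_pos ht]; ring
  · have h0 : ∑ i ∈ Finset.Ico m (m + j), (if x (wire m j i) then (2 : ℝ) ^ i else 0) =
        2 ^ (m + j) - 2 ^ m := by
      rw [← sum_two_pow_Ico]
      exact Finset.sum_congr rfl fun i hi => by simp [h i hi, ht]
    rw [_root_.gridPoint_eq x
      ((∑ i ∈ Finset.range m, if x (wire m j i) then (2 : ℝ) ^ i else 0) - 2 ^ m)]
    · simp only [windowPoint, ht]
      field_simp
      simp
      ring
    · rw [bitsToNat_eq_sum, h0, if_neg ht]; ring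

theorem one_le_gridPoint_of_not_inWindow (h : ¬ InWindow m j x) :
    1 ≤ |gridPoint (-1) 1 (m + j + 1) (bitsToNat x) * 2 ^ j| := by
  have hlow0 : 0 ≤ ∑ i ∈ Finset.range m, (if x (wire m j i) then (2 : ℝ) ^ i else 0) :=
    Finset.sum_nonneg fun i _ => by split_ifs <;> positivity
  have hlow1 : ∑ i ∈ Finset.range m, (if x (wire m j i) then (2 : ℝ) ^ i else 0) ≤ 2 ^ m := by
    calc _ ≤ ∑ i ∈ Finset.range m, (2 : ℝ) ^ i :=
          Finset.sum_le_sum fun i _ => by split_ifs <;> [exact le_rfl; positivity]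
      _ ≤ 2 ^ m := by rw [geom_sum_eq (by norm_num)]; norm_num
  unfold InWindow at h
  push Not at h
  obtain ⟨i, hi, hne⟩ := h
  have him : (2 : ℝ) ^ m ≤ 2 ^ i := by
    gcongr
    · norm_num
    · exact (Finset.mem_Ico.1 hi).1
  by_cases ht : x (wire m j (m + j))
  · have hxi : x (wire m j i) = true := by simpa [ht] using hne
    have hmid : (2 : ℝ) ^ m ≤
        ∑ i ∈ Finset.Ico m (m + j), (if x (wire m j i) then (2 : ℝ) ^ i else 0) := by
      refine him.trans ?_
      have := Finset.single_le_sum (f := fun i => if x (wire m j i) then (2 : ℝ) ^ i else 0)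
        (fun i _ => by split_ifs <;> positivity) hi
      simpa [hxi] using this
    rw [gridPoint_eq x _ (by rw [bitsToNat_eq_sum, if_pos ht, add_comm])]
    refine le_trans ?_ (le_abs_self _)
    rw [le_div_iff₀ (by positivity)]
    linarith
  · have hxi : x (wire m j i) = false := by simpa [ht] using hne
    have hmid : ∑ i ∈ Finset.Ico m (m + j), (if x (wire m j i) then (2 : ℝ) ^ i else 0) ≤
        2 ^ (m + j) - 2 ^ m - 2 ^ m := by
      rw [← sum_two_pow_Ico, ← Finset.add_sum_erase _ _ hi, ← Finset.add_sum_erase _ _ hi]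
      simp only [hxi]
      have : ∑ i ∈ (Finset.Ico m (m + j)).erase i, (if x (wire m j i) then (2 : ℝ) ^ i else 0) ≤
          ∑ i ∈ (Finset.Ico m (m + j)).erase i, (2 : ℝ) ^ i :=
        Finset.sum_le_sum fun i _ => by split_ifs <;> [exact le_rfl; positivity]
      simp
      linarith
    rw [gridPoint_eq x (bitsToNat x - 2 ^ (m + j)) (by ring), bitsToNat_eq_sum, if_neg ht]
    refine le_trans ?_ (neg_le_abs _)
    rw [← neg_div, le_div_iff₀ (by positivity)]
    linarith

end Digits

/-- The uniform superposition of the grid points in the window. -/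
theorem exists_inWindow_circuit (m j : ℕ) [DecidablePred (InWindow m j)] :
    ∃ c : List (QGate (Fin (m + j + 1))), c.length ≤ 2 * (m + j + 1) ∧
      runCircuit c (zeroState _) = fun x =>
        if InWindow m j x then ((√(1 / 2) ^ (m + 1) : ℝ) : ℂ) else 0 := by
  have hinj : Set.InjOn (wire m j) (Finset.Ico m (m + j)) := by
    intro i hi i' hi' h
    simp only [Finset.coe_Ico, Set.mem_Ico] at hi hi'
    exact wire_inj (by omega) (by omega) h
  obtain ⟨c, h1, h2⟩ := exists_window_circuit (wire m j (m + j))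
    ((Finset.Ico m (m + j)).image (wire m j)) (by
      simp only [Finset.mem_image, Finset.mem_Ico, not_exists, not_and]
      intro i hi h
      have := wire_inj (by omega) (by omega) h
      omega)
  refine ⟨c, by simpa using h1, ?_⟩
  rw [h2, Finset.card_image_of_injOn hinj]
  ext x
  have : (∀ q ∈ (Finset.Ico m (m + j)).image (wire m j), x q = !(x (wire m j (m + j)))) ↔
      InWindow m j x := by
    simp only [Finset.forall_mem_image, InWindow]
  have hcard : Fintype.card (Fin (m + j + 1)) - (Finset.Ico m (m + j)).card = m + 1 := by
    simp
    omega
  simp only [this, hcard]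

/-! ### The Gaussian and the Kaiser window as mixtures of powers of `1 - x ^ 2` -/

/-- On `[-1, 1]`, the function `f` is the mixture of the powers `(1 - x ^ 2) ^ k` with
probabilities `w k`, where the exponential moment `∑ w k * 2 ^ k` is at most `exp (2 * β)`, and
`f` does not drop below `1 / 2` for `β * x ^ 2 ≤ 1`. -/
structure IsPowerMixture (f : ℝ → ℝ) (β : ℝ) (w : ℕ → ℝ) : Prop where
  nonneg : ∀ k, 0 ≤ w k
  hasSum_one : HasSum w 1
  hasSum : ∀ x, |x| ≤ 1 → HasSum (fun k => w k * (1 - x ^ 2) ^ k) (f x)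
  moment : ∃ s ≤ Real.exp (2 * β), HasSum (fun k => w k * 2 ^ k) s
  half_le : ∀ x, |x| ≤ 1 → β * x ^ 2 ≤ 1 → 1 / 2 ≤ f x

namespace IsPowerMixture

variable {f : ℝ → ℝ} {β : ℝ} {w : ℕ → ℝ}

theorem sum_le_one (h : IsPowerMixture f β w) (D : ℕ) : ∑ k ∈ Finset.range (D + 1), w k ≤ 1 :=
  sum_le_hasSum _ (fun k _ => h.nonneg k) h.hasSum_one

theorem sum_nonneg (h : IsPowerMixture f β w) (D : ℕ) {x : ℝ} (hx : |x| ≤ 1) :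
    0 ≤ ∑ k ∈ Finset.range (D + 1), w k * (1 - x ^ 2) ^ k := by
  have : x ^ 2 ≤ 1 := (sq_le_one_iff_abs_le_one x).2 hx
  exact Finset.sum_nonneg fun k _ => mul_nonneg (h.nonneg k) (pow_nonneg (by linarith) k)

theorem sum_le (h : IsPowerMixture f β w) (D : ℕ) {x : ℝ} (hx : |x| ≤ 1) :
    ∑ k ∈ Finset.range (D + 1), w k * (1 - x ^ 2) ^ k ≤ f x := by
  have : x ^ 2 ≤ 1 := (sq_le_one_iff_abs_le_one x).2 hx
  exact sum_le_hasSum _ (fun k _ => mul_nonneg (h.nonneg k) (pow_nonneg (by linarith) k))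
    (h.hasSum x hx)

theorem le_sum_add (h : IsPowerMixture f β w) (D : ℕ) {x : ℝ} (hx : |x| ≤ 1) :
    f x ≤ ∑ k ∈ Finset.range (D + 1), w k * (1 - x ^ 2) ^ k + Real.exp (2 * β) / 2 ^ D := by
  have hx2 : x ^ 2 ≤ 1 := (sq_le_one_iff_abs_le_one x).2 hx
  obtain ⟨s, hs, hsum⟩ := h.moment
  have h1 : HasSum (fun k => if k ∈ Finset.range (D + 1) then w k * (1 - x ^ 2) ^ k else 0)
      (∑ k ∈ Finset.range (D + 1), w k * (1 - x ^ 2) ^ k) := by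
    rw [← Finset.sum_congr rfl fun k hk => if_pos hk]
    exact hasSum_sum_of_ne_finset_zero fun k hk => if_neg hk
  refine (hasSum_le (fun k => ?_) (h.hasSum x hx) (h1.add (hsum.div_const (2 ^ D)))).trans
    (by gcongr)
  have hp : (1 - x ^ 2) ^ k ≤ 1 := pow_le_one₀ (by linarith) (by nlinarith [sq_nonneg x])
  have hw := h.nonneg k
  split_ifs with hk
  · have : 0 ≤ w k * 2 ^ k / 2 ^ D := by positivity
    linarith
  · have hDk : D ≤ k := by
      rw [Finset.mem_range] at hk
      omega
    have : (2 : ℝ) ^ D ≤ 2 ^ k := pow_le_pow_right₀ one_le_two hDk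
    rw [zero_add, mul_div_assoc]
    gcongr
    refine hp.trans ?_
    rwa [le_div_iff₀ (by positivity), one_mul]

end IsPowerMixture

theorem hasSum_pow_div_factorial (t : ℝ) :
    HasSum (fun k : ℕ => t ^ k / (k.factorial : ℝ)) (Real.exp t) := by
  rw [Real.exp_eq_exp_ℝ]
  exact NormedSpace.expSeries_div_hasSum_exp t

/-- The weights are those of the Poisson distribution of mean `β / 2`. -/
theorem isPowerMixture_gaussianFun {β : ℝ} (hβ : 0 ≤ β) :
    IsPowerMixture (gaussianFun β) β
      fun k => Real.exp (-(β / 2)) * ((β / 2) ^ k / (k.factorial : ℝ)) where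
  nonneg k := by positivity
  hasSum_one := by
    have := (hasSum_pow_div_factorial (β / 2)).mul_left (Real.exp (-(β / 2)))
    rwa [← Real.exp_add, neg_add_cancel, Real.exp_zero] at this
  hasSum x _ := by
    have := (hasSum_pow_div_factorial (β / 2 * (1 - x ^ 2))).mul_left (Real.exp (-(β / 2)))
    rw [← Real.exp_add] at this
    have hf : gaussianFun β x = Real.exp (-(β / 2) + β / 2 * (1 - x ^ 2)) := by
      rw [gaussianFun]; congr 1; ring
    rw [hf]
    convert! this using 2 with k
    rw [mul_pow]; ring
  moment := by
    refine ⟨Real.exp (-(β / 2)) * Real.exp (β / 2 * 2), ?_, ?_⟩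
    · rw [← Real.exp_add]
      exact Real.exp_le_exp.2 (by linarith)
    · have := (hasSum_pow_div_factorial (β / 2 * 2)).mul_left (Real.exp (-(β / 2)))
      convert! this using 2 with k
      rw [mul_pow]; ring
  half_le x _ hx := by
    have := Real.add_one_le_exp (-(β / 2) * x ^ 2)
    rw [gaussianFun]
    linarith

theorem summable_besselI0 (z : ℝ) :
    Summable fun k : ℕ => (z ^ 2 / 4) ^ k / (k.factorial : ℝ) ^ 2 := by
  refine Summable.of_nonneg_of_le (fun k => by positivity) (fun k => ?_)
    (hasSum_pow_div_factorial (z ^ 2 / 4)).summable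
  have : (1 : ℝ) ≤ k.factorial := by exact_mod_cast Nat.one_le_iff_ne_zero.2 k.factorial_ne_zero
  gcongr
  nlinarith

theorem hasSum_besselI0 (z : ℝ) :
    HasSum (fun k : ℕ => (z ^ 2 / 4) ^ k / (k.factorial : ℝ) ^ 2) (besselI0 z) :=
  (summable_besselI0 z).hasSum

theorem one_le_besselI0 (z : ℝ) : 1 ≤ besselI0 z := by
  have := sum_le_hasSum {0} (fun k _ => by positivity) (hasSum_besselI0 z)
  simpa using this

/-- The mean of the weights of the Kaiser window is at most `β / 2`, in terms of the summands
`b k` of `besselI0 β`: by the inequality of the means, `2 * k * b k` is at most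
`β / 2 * (b k + b (k - 1))`. -/
theorem besselI0_mul_le {β : ℝ} (hβ : 0 ≤ β) {x : ℝ} (hx : |x| ≤ 1) :
    (1 - β / 2 * x ^ 2) * besselI0 β ≤ besselI0 (β * √(1 - x ^ 2)) := by
  have hx2 : x ^ 2 ≤ 1 := (sq_le_one_iff_abs_le_one x).2 hx
  set b : ℕ → ℝ := fun k => (β ^ 2 / 4) ^ k / (k.factorial : ℝ) ^ 2 with hb
  have hb0 : ∀ k, 0 ≤ b k := fun k => by positivity
  have h0 : HasSum b (besselI0 β) := hasSum_besselI0 β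
  let b' : ℕ → ℝ := fun k => if k = 0 then 0 else b (k - 1)
  have h1 : HasSum b' (besselI0 β) := by
    rw [← hasSum_nat_add_iff' 1]
    simpa [b'] using h0
  have h2 := hasSum_besselI0 (β * √(1 - x ^ 2))
  have h3 := h0.sub ((h0.add h1).mul_left (x ^ 2 * (β / 4)))
  have e : besselI0 β - x ^ 2 * (β / 4) * (besselI0 β + besselI0 β) =
      (1 - β / 2 * x ^ 2) * besselI0 β := by ring
  rw [e] at h3
  refine hasSum_le (fun k => ?_) h3 h2
  have e2 : ((β * √(1 - x ^ 2)) ^ 2 / 4) ^ k / (k.factorial : ℝ) ^ 2 = b k * (1 - x ^ 2) ^ k := by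
    rw [mul_pow, Real.sq_sqrt (by linarith), mul_div_right_comm, mul_pow, hb]
    ring
  rw [e2]
  have hbern : 1 - k * x ^ 2 ≤ (1 - x ^ 2) ^ k := by
    have := one_add_mul_le_pow (a := -x ^ 2) (by linarith) k
    rw [← sub_eq_add_neg] at this
    linarith
  have hk : k * b k ≤ β / 4 * (b k + b' k) := by
    cases k with
    | zero => simp [b']; positivity
    | succ k =>
      simp only [b', Nat.add_eq_zero_iff, one_ne_zero, and_false, if_false, Nat.add_sub_cancel, hb]
      set c : ℝ := (β / 2) ^ k / (k.factorial : ℝ) with hc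
      have e3 : (β ^ 2 / 4) ^ k / (k.factorial : ℝ) ^ 2 = c ^ 2 := by
        rw [hc, show β ^ 2 / 4 = (β / 2) ^ 2 by ring, div_pow _ (k.factorial : ℝ), ← pow_mul,
          ← pow_mul, mul_comm]
      have hk1 : (0 : ℝ) < k + 1 := by positivity
      have e4 : (β ^ 2 / 4) ^ (k + 1) / ((k + 1).factorial : ℝ) ^ 2 =
          (β / 2 * c / (k + 1)) ^ 2 := by
        rw [Nat.factorial_succ, pow_succ, hc]
        push_cast
        have : (β ^ 2 / 4) ^ k = ((β / 2) ^ k) ^ 2 := by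
          rw [show β ^ 2 / 4 = (β / 2) ^ 2 by ring, ← pow_mul, ← pow_mul, mul_comm]
        rw [this]
        field_simp
        ring
      rw [e3, e4]
      set d : ℝ := β / 2 * c / (k + 1) with hd
      have e5 : (k + 1 : ℝ) * d = β / 2 * c := by rw [hd]; field_simp
      push_cast
      have : (k + 1 : ℝ) * d ^ 2 = β / 2 * (c * d) := by
        rw [sq, ← mul_assoc, e5]; ring
      rw [this]
      nlinarith [mul_nonneg hβ (sq_nonneg (c - d))]
  have := mul_le_mul_of_nonneg_left hk (sq_nonneg x)
  have := mul_le_mul_of_nonneg_left hbern (hb0 k)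
  linarith

theorem isPowerMixture_kaiserWindow {β : ℝ} (hβ : 0 ≤ β) :
    IsPowerMixture (kaiserWindow β) β
      fun k => (β ^ 2 / 4) ^ k / (k.factorial : ℝ) ^ 2 / besselI0 β where
  nonneg k := by
    have := one_le_besselI0 β
    positivity
  hasSum_one := by
    have := (hasSum_besselI0 β).div_const (besselI0 β)
    rwa [div_self (by linarith [one_le_besselI0 β])] at this
  hasSum x hx := by
    have hx2 : x ^ 2 ≤ 1 := (sq_le_one_iff_abs_le_one x).2 hx
    have := (hasSum_besselI0 (β * √(1 - x ^ 2))).div_const (besselI0 β)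
    rw [kaiserWindow]
    convert! this using 2 with k
    rw [mul_pow, Real.sq_sqrt (by linarith), mul_div_right_comm, mul_pow]
    ring
  moment := by
    have h1 := one_le_besselI0 β
    have hle : ∀ k : ℕ, (β ^ 2 / 4) ^ k / (k.factorial : ℝ) ^ 2 / besselI0 β * 2 ^ k ≤
        Real.exp β * (β ^ k / (k.factorial : ℝ)) := by
      intro k
      have h2 : β ^ k / (k.factorial : ℝ) ≤ Real.exp β := by
        have := sum_le_hasSum {k} (fun k _ => by positivity) (hasSum_pow_div_factorial β)
        simpa using this
      have h3 : 0 ≤ β ^ k / (k.factorial : ℝ) := by positivity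
      calc (β ^ 2 / 4) ^ k / (k.factorial : ℝ) ^ 2 / besselI0 β * 2 ^ k
          ≤ (β ^ 2 / 4) ^ k / (k.factorial : ℝ) ^ 2 * 2 ^ k :=
            mul_le_mul_of_nonneg_right (div_le_self (by positivity) h1) (by positivity)
        _ = (β ^ 2 / 2) ^ k / (k.factorial : ℝ) ^ 2 := by
            rw [div_mul_eq_mul_div, ← mul_pow]; congr 2; ring
        _ ≤ (β ^ 2) ^ k / (k.factorial : ℝ) ^ 2 := by
            gcongr
            linarith [sq_nonneg β]
        _ = (β ^ k / (k.factorial : ℝ)) * (β ^ k / (k.factorial : ℝ)) := by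
            rw [div_mul_div_comm, ← sq, ← sq, ← pow_mul, ← pow_mul, mul_comm k 2]
        _ ≤ _ := by gcongr
    have hs := (hasSum_pow_div_factorial β).mul_left (Real.exp β)
    have hsum : Summable fun k : ℕ =>
        (β ^ 2 / 4) ^ k / (k.factorial : ℝ) ^ 2 / besselI0 β * 2 ^ k :=
      Summable.of_nonneg_of_le (fun k => by positivity) hle hs.summable
    refine ⟨_, ?_, hsum.hasSum⟩
    rw [two_mul, Real.exp_add]
    exact hasSum_le hle hsum.hasSum hs
  half_le x hx hβx := by
    have h1 := one_le_besselI0 β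
    have h2 := besselI0_mul_le hβ hx
    rw [kaiserWindow, le_div_iff₀ (by linarith)]
    nlinarith

/-! ### Preparing a mixture on a window -/

theorem norm_normalize_sub_le {V : Type} [NormedAddCommGroup V] [NormedSpace ℝ V] {p q : V}
    (hp : 0 < ‖p‖) (hq : 0 < ‖q‖) :
    ‖(‖p‖⁻¹ • p) - (‖q‖⁻¹ • q)‖ ≤ 2 * ‖p - q‖ / ‖q‖ := by
  have h : (‖p‖⁻¹ • p) - (‖q‖⁻¹ • q) = (‖p‖⁻¹ - ‖q‖⁻¹) • p + ‖q‖⁻¹ • (p - q) := by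
    rw [sub_smul, smul_sub]; abel
  have h1 : ‖(‖p‖⁻¹ - ‖q‖⁻¹) • p‖ ≤ ‖p - q‖ / ‖q‖ := by
    rw [norm_smul, Real.norm_eq_abs]
    have : ‖p‖⁻¹ - ‖q‖⁻¹ = (‖q‖ - ‖p‖) / (‖p‖ * ‖q‖) := by field_simp
    rw [this, abs_div, abs_of_pos (mul_pos hp hq)]
    have := abs_norm_sub_norm_le q p
    rw [norm_sub_rev] at this
    rw [div_mul_eq_mul_div, div_le_div_iff₀ (mul_pos hp hq) hq]
    calc |‖q‖ - ‖p‖| * ‖p‖ * ‖q‖ ≤ ‖p - q‖ * ‖p‖ * ‖q‖ := by gcongr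
      _ = ‖p - q‖ * (‖p‖ * ‖q‖) := by ring
  have h2 : ‖‖q‖⁻¹ • (p - q)‖ = ‖p - q‖ / ‖q‖ := by
    rw [norm_smul, norm_inv, norm_norm]; field_simp
  rw [h]
  refine (norm_add_le _ _).trans ?_
  rw [h2, mul_div_assoc]
  linarith

theorem sum_normalize_sub_sq_le {ι : Type} [Fintype ι] {p q : ι → ℝ} (hp : 0 < ∑ i, p i ^ 2)
    (hq : 0 < ∑ i, q i ^ 2) :
    ∑ i, (p i / √(∑ i, p i ^ 2) - q i / √(∑ i, q i ^ 2)) ^ 2 ≤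
      4 * (∑ i, (p i - q i) ^ 2) / ∑ i, q i ^ 2 := by
  have hn : ∀ v : ι → ℝ, ‖(WithLp.toLp 2 v : EuclideanSpace ℝ ι)‖ = √(∑ i, v i ^ 2) := by
    intro v
    rw [EuclideanSpace.norm_eq]
    simp
  have h := norm_normalize_sub_le (p := (WithLp.toLp 2 p : EuclideanSpace ℝ ι))
    (q := (WithLp.toLp 2 q : EuclideanSpace ℝ ι)) (by rw [hn]; exact Real.sqrt_pos.2 hp)
    (by rw [hn]; exact Real.sqrt_pos.2 hq)
  have h2 : ∀ v : ι → ℝ, 0 ≤ ∑ i, v i ^ 2 := fun v => Finset.sum_nonneg fun i _ => sq_nonneg _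
  rw [← WithLp.toLp_sub, ← WithLp.toLp_smul, ← WithLp.toLp_smul, ← WithLp.toLp_sub, hn, hn, hn,
    hn] at h
  have h3 := pow_le_pow_left₀ (Real.sqrt_nonneg _) h 2
  rw [Real.sq_sqrt (h2 _), div_pow, mul_pow, Real.sq_sqrt (h2 _), Real.sq_sqrt (h2 _)] at h3
  have h4 : ∀ i, p i / √(∑ i, p i ^ 2) - q i / √(∑ i, q i ^ 2) =
      ((√(∑ i, p i ^ 2))⁻¹ • p - (√(∑ i, q i ^ 2))⁻¹ • q) i := by
    intro i
    simp only [Pi.sub_apply, Pi.smul_apply, smul_eq_mul]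
    ring
  simp only [h4]
  refine h3.trans (le_of_eq ?_)
  norm_num

theorem abs_windowPoint_le {m j : ℕ} (x : Fin (m + j + 1) → Bool) : |windowPoint m j x| ≤ 1 := by
  have h0 : 0 ≤ ∑ i ∈ Finset.range m, (if x (wire m j i) then (2 : ℝ) ^ i else 0) :=
    Finset.sum_nonneg fun i _ => by split_ifs <;> positivity
  have h1 : ∑ i ∈ Finset.range m, (if x (wire m j i) then (2 : ℝ) ^ i else 0) ≤ 2 ^ m := by
    calc _ ≤ ∑ i ∈ Finset.range m, (2 : ℝ) ^ i :=
          Finset.sum_le_sum fun i _ => by split_ifs <;> [exact le_rfl; positivity]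
      _ ≤ 2 ^ m := by rw [geom_sum_eq (by norm_num)]; norm_num
  have h2 := div_nonneg h0 (by positivity : (0 : ℝ) ≤ 2 ^ m)
  have h3 := div_le_one_of_le₀ h1 (by positivity : (0 : ℝ) ≤ 2 ^ m)
  rw [windowPoint, abs_le]
  split_ifs <;> constructor <;> linarith

/-- The mean square over the window of a function that is at least `1 / 4` where
`β * x ^ 2 ≤ 1`: already the points of `[0, 1 / √(β + 1)]` contribute enough. -/
theorem le_sum_window_sq {m j : ℕ} [DecidablePred (InWindow m j)] {β : ℝ} (hβ : 0 ≤ β)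
    {g : ℝ → ℝ} (hg : ∀ v, |v| ≤ 1 → β * v ^ 2 ≤ 1 → 1 / 4 ≤ g v) :
    2 ^ (m + 1) / (32 * √(β + 1)) ≤
      ∑ x : Fin (m + j + 1) → Bool, (if InWindow m j x then g (windowPoint m j x) else 0) ^ 2 := by
  have hsq : 0 < √(β + 1) := Real.sqrt_pos.2 (by linarith)
  have hsq2 : √(β + 1) ^ 2 = β + 1 := Real.sq_sqrt (by linarith)
  have hsq1 : 1 ≤ √(β + 1) := Real.one_le_sqrt.2 (by linarith)
  set V : ℕ := min (2 ^ m) (⌊2 ^ m / √(β + 1)⌋₊ + 1) with hV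
  have hVle : 2 ^ m / √(β + 1) ≤ (V : ℝ) := by
    rw [hV, Nat.cast_min]
    refine le_min ?_ ?_
    · push_cast
      exact div_le_self (by positivity) hsq1
    · push_cast
      exact (Nat.lt_floor_add_one _).le
  have hterm : ∀ x : Fin (m + j + 1) → Bool,
      (if bitsToNat x ∈ Finset.Ico (2 ^ (m + j)) (2 ^ (m + j) + V) then (1 / 16 : ℝ) else 0) ≤
        (if InWindow m j x then g (windowPoint m j x) else 0) ^ 2 := by
    intro x
    split_ifs with hx hw hw
    · rw [Finset.mem_Ico] at hx
      obtain ⟨i, hi⟩ := Nat.exists_eq_add_of_le hx.1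
      have hiV : i < V := by omega
      have hi2 : (i : ℝ) ≤ 2 ^ m / √(β + 1) := by
        have : i ≤ ⌊2 ^ m / √(β + 1)⌋₊ := by omega
        exact (Nat.le_floor_iff (by positivity)).1 this
      have hgrid : windowPoint m j x = i / 2 ^ m := by
        rw [← hw.gridPoint_eq, gridPoint_eq x i (by rw [hi]; push_cast; ring)]
      have hv : |windowPoint m j x| * √(β + 1) ≤ 1 := by
        rw [hgrid, abs_of_nonneg (by positivity), div_mul_eq_mul_div,
          div_le_one (by positivity), ← le_div_iff₀ hsq]
        exact hi2
      have hb : β * windowPoint m j x ^ 2 ≤ 1 := by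
        have h1 := pow_le_one₀ (n := 2) (by positivity) hv
        rw [mul_pow, sq_abs, hsq2] at h1
        nlinarith [sq_nonneg (windowPoint m j x)]
      have := hg _ (abs_windowPoint_le x) hb
      nlinarith
    · exfalso
      rw [Finset.mem_Ico] at hx
      obtain ⟨i, hi⟩ := Nat.exists_eq_add_of_le hx.1
      have hiV : i < 2 ^ m := by omega
      have := one_le_gridPoint_of_not_inWindow x hw
      rw [gridPoint_eq x i (by rw [hi]; push_cast; ring), abs_of_nonneg (by positivity),
        le_div_iff₀ (by positivity), one_mul] at this
      have h2 : (i : ℝ) < 2 ^ m := by exact_mod_cast hiV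
      linarith
    · positivity
    · positivity
  refine le_trans ?_ (Finset.sum_le_sum fun x _ => hterm x)
  rw [sum_bitsToNat (m + j + 1) (fun k =>
    if k ∈ Finset.Ico (2 ^ (m + j)) (2 ^ (m + j) + V) then (1 / 16 : ℝ) else 0),
    ← Finset.sum_filter]
  have hfilter : (Finset.range (2 ^ (m + j + 1))).filter
      (fun k => k ∈ Finset.Ico (2 ^ (m + j)) (2 ^ (m + j) + V)) =
      Finset.Ico (2 ^ (m + j)) (2 ^ (m + j) + V) := by
    ext k
    have h1 : V ≤ 2 ^ m := min_le_left _ _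
    have h2 : 2 ^ m ≤ 2 ^ (m + j) := Nat.pow_le_pow_right (by norm_num) (by omega)
    have h3 : 2 ^ (m + j + 1) = 2 ^ (m + j) + 2 ^ (m + j) := by rw [pow_succ]; ring
    simp only [Finset.mem_filter, Finset.mem_range, Finset.mem_Ico]
    omega
  rw [hfilter, Finset.sum_const, Nat.card_Ico, Nat.add_sub_cancel_left, nsmul_eq_mul]
  have : (2 : ℝ) ^ (m + 1) / (32 * √(β + 1)) = 2 ^ m / √(β + 1) * (1 / 16) := by
    rw [pow_succ]; field_simp; norm_num
  rw [this]
  gcongr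

/-- Preparation of a function `F` which coincides on the window `[-2⁻ʲ, 2⁻ʲ]` with a rescaled
mixture `f` of powers and carries little weight outside. The mixture is truncated at the power
`D`. -/
theorem canPrepare_of_isPowerMixture (m j : ℕ) [DecidablePred (InWindow m j)] {f F : ℝ → ℝ}
    {β : ℝ} {w : ℕ → ℝ} (h : IsPowerMixture f β w) (hβ : 0 ≤ β)
    (hF : ∀ x, |x * 2 ^ j| ≤ 1 → F x = f (x * 2 ^ j)) {τ : ℝ}
    (hτ : ∑ x : Fin (m + j + 1) → Bool, (if InWindow m j x then 0 else
        F (gridPoint (-1) 1 (m + j + 1) (bitsToNat x)) ^ 2) ≤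
      τ * ∑ x : Fin (m + j + 1) → Bool, F (gridPoint (-1) 1 (m + j + 1) (bitsToNat x)) ^ 2)
    (D : ℕ) (hD : Real.exp (2 * β) / 2 ^ D ≤ 1 / 4) {ε : ℝ} (hε : 0 ≤ ε)
    (herr : 4 * (32 * (Real.exp (2 * β) / 2 ^ D) ^ 2 * √(β + 1) + τ) ≤ ε ^ 2) :
    CanPrepare (functionState F (-1) 1 (m + j + 1)) ε
      (1530000 * ((m + j + 1 : ℕ) * (β + 1) ^ (1 / 4 : ℝ) * (D + 1))) := by
  set δ := Real.exp (2 * β) / 2 ^ D with hδ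
  have hδ0 : 0 ≤ δ := by positivity
  let g : ℝ → ℝ := fun v => ∑ k ∈ Finset.range (D + 1), w k * (1 - v ^ 2) ^ k
  set p : (Fin (m + j + 1) → Bool) → ℝ :=
    fun x => if InWindow m j x then g (windowPoint m j x) else 0 with hp
  set q : (Fin (m + j + 1) → Bool) → ℝ :=
    fun x => F (gridPoint (-1) 1 (m + j + 1) (bitsToNat x)) with hq
  have hgf : ∀ x, InWindow m j x → 0 ≤ g (windowPoint m j x) ∧ g (windowPoint m j x) ≤ q x ∧
      q x ≤ g (windowPoint m j x) + δ := by
    intro x hx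
    have hv := abs_windowPoint_le x
    have hqx : q x = f (windowPoint m j x) := by
      rw [hq, ← hx.gridPoint_eq]
      exact hF _ (by rwa [hx.gridPoint_eq])
    rw [hqx]
    exact ⟨h.sum_nonneg D hv, h.sum_le D hv, h.le_sum_add D hv⟩
  set A := ∑ x, p x ^ 2 with hA
  have hAle : 2 ^ (m + 1) / (32 * √(β + 1)) ≤ A := by
    refine le_sum_window_sq hβ fun v hv hβv => ?_
    have h1 := h.le_sum_add D hv
    have h2 := h.half_le v hv hβv
    change 1 / 4 ≤ ∑ k ∈ Finset.range (D + 1), w k * (1 - v ^ 2) ^ k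
    linarith
  have hs0 : 0 < √(β + 1) := Real.sqrt_pos.2 (by linarith)
  have hA0 : 0 < A := lt_of_lt_of_le (by positivity) hAle
  set Q := ∑ x, q x ^ 2 with hQ
  have hAQ : A ≤ Q := by
    refine Finset.sum_le_sum fun x _ => ?_
    by_cases hx : InWindow m j x
    · obtain ⟨h1, h2, -⟩ := hgf x hx
      simp only [hp, if_pos hx]
      gcongr
    · simp only [hp, if_neg hx, zero_pow two_ne_zero]
      exact sq_nonneg _
  have hQ0 : 0 < Q := hA0.trans_le hAQ
  obtain ⟨P, hP1, hP2⟩ := exists_inWindow_circuit m j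
  set η : ℝ := √(1 / 2) ^ (m + 1) with hη
  have hη0 : 0 < η := by positivity
  have hη2 : η ^ 2 * 2 ^ (m + 1) = 1 := by
    rw [hη, ← pow_mul, mul_comm (m + 1) 2, pow_mul, Real.sq_sqrt (by norm_num), ← mul_pow]
    norm_num
  have hu : ∀ x, ‖runCircuit P (zeroState _) x‖ ^ 2 = if InWindow m j x then η ^ 2 else 0 := by
    intro x
    simp only [hP2]
    split_ifs with hx
    · rw [Complex.norm_real, Real.norm_of_nonneg hη0.le]
    · simp
  -- the window consists of `2 ^ (m + 1)` points, since `P` prepares a unit vector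
  have hcount : ∑ x : Fin (m + j + 1) → Bool, (if InWindow m j x then (1 : ℝ) else 0) =
      2 ^ (m + 1) := by
    have h1 := runCircuit_isometry P (zeroState _)
    have h2 : ∑ x, ‖zeroState (Fin (m + j + 1)) x‖ ^ 2 = 1 := by
      rw [Finset.sum_eq_single fun _ => false]
      · simp [zeroState_apply]
      · intro z _ hz
        simp [zeroState_apply, hz]
      · simp
    have h3 : ∑ x : Fin (m + j + 1) → Bool, (if InWindow m j x then η ^ 2 else 0) =
        η ^ 2 * ∑ x : Fin (m + j + 1) → Bool, (if InWindow m j x then (1 : ℝ) else 0) := by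
      rw [Finset.mul_sum]
      simp
    rw [h2, Finset.sum_congr rfl fun x _ => hu x, h3] at h1
    have : η ^ 2 ≠ 0 := by positivity
    exact mul_left_cancel₀ this (h1.trans hη2.symm)
  have hSq : Samples (fun x => g (windowPoint m j x)) (D * (40 * m + 61 + 19) + 1) :=
    (Samples.one_sub_sq (wire m j) m (wire m j (m + j))).polynomial D w h.nonneg (h.sum_le_one D)
  have hA1 : A ≤ 2 ^ (m + 1) := by
    rw [← hcount]
    refine Finset.sum_le_sum fun x _ => ?_
    by_cases hx : InWindow m j x
    · have hv := abs_windowPoint_le x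
      have hv2 : windowPoint m j x ^ 2 ≤ 1 := (sq_le_one_iff_abs_le_one _).2 hv
      have h1 : g (windowPoint m j x) ≤ 1 := by
        refine le_trans (Finset.sum_le_sum fun k _ => ?_) (h.sum_le_one D)
        exact mul_le_of_le_one_right (h.nonneg k)
          (pow_le_one₀ (by linarith) (by nlinarith [sq_nonneg (windowPoint m j x)]))
      simp only [hp, if_pos hx]
      exact pow_le_one₀ (hgf x hx).1 h1
    · simp [hp, if_neg hx]
  set a : ℝ := √A * η with ha
  have ha0 : 0 < a := mul_pos (Real.sqrt_pos.2 hA0) hη0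
  have ha2 : a ^ 2 = A * η ^ 2 := by rw [ha, mul_pow, Real.sq_sqrt hA0.le]
  have ha1 : a ≤ 1 := by
    rw [← sq_le_one_iff₀ ha0.le, ha2, ← hη2, mul_comm]
    gcongr
  obtain ⟨B, i1, i2, c, hc1, hc2⟩ := exists_circuit_mul P _ hSq a ha0 ha1 (by
    rw [ha2, hA, Finset.sum_mul]
    refine Finset.sum_congr rfl fun x _ => ?_
    rw [hu]
    simp only [hp]
    split_ifs <;> ring)
  have hψ : (fun x => ((g (windowPoint m j x) / a : ℝ) : ℂ) * runCircuit P (zeroState _) x) =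
      fun x => ((p x / √A : ℝ) : ℂ) := by
    ext x
    rw [hP2]
    simp only [hp]
    split_ifs
    · rw [← Complex.ofReal_mul, ha]
      congr 1
      have := (Real.sqrt_pos.2 hA0).ne'
      field_simp
    · simp
  have hΨ : functionState F (-1) 1 (m + j + 1) = fun x => ((q x / √Q : ℝ) : ℂ) := by
    have : gridNorm F (-1) 1 (m + j + 1) = √Q := by
      rw [gridNorm, hQ]
      simp only [hq, sq_abs]
      rw [sum_bitsToNat (m + j + 1) (fun k => F (gridPoint (-1) 1 (m + j + 1) k) ^ 2)]
    ext x
    rw [functionState, this]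
  rw [hψ] at hc2
  refine canPrepare_of_runCircuit c _ _ hc2 ?_ ?_ (hc1.trans ?_)
  · rw [hΨ]
    simp only [Complex.norm_real, Real.norm_eq_abs, sq_abs, div_pow, Real.sq_sqrt hQ0.le]
    rw [← Finset.sum_div, ← hQ, div_self hQ0.ne']
  · rw [hΨ]
    simp only [← Complex.ofReal_sub, Complex.norm_real, Real.norm_eq_abs, sq_abs]
    rw [← Real.sqrt_sq hε]
    refine Real.sqrt_le_sqrt ((sum_normalize_sub_sq_le hA0 hQ0).trans (le_trans ?_ herr))
    have hdiff : ∑ x, (p x - q x) ^ 2 ≤ δ ^ 2 * 2 ^ (m + 1) + τ * Q := by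
      rw [← hcount, Finset.mul_sum]
      refine le_trans ?_ (add_le_add_right hτ _)
      rw [← Finset.sum_add_distrib]
      refine Finset.sum_le_sum fun x _ => ?_
      by_cases hx : InWindow m j x
      · obtain ⟨h1, h2, h3⟩ := hgf x hx
        simp only [hp, if_pos hx, mul_one, add_zero]
        rw [← neg_sub, neg_sq]
        exact pow_le_pow_left₀ (by linarith) (by linarith) 2
      · simp only [hp, if_neg hx]
        simp [hq]
    rw [← hQ, div_le_iff₀ hQ0]
    have h32 : δ ^ 2 * 2 ^ (m + 1) ≤ 32 * δ ^ 2 * √(β + 1) * Q := by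
      have : 2 ^ (m + 1) ≤ 32 * √(β + 1) * Q := by
        rw [div_le_iff₀ (by positivity)] at hAle
        nlinarith
      calc δ ^ 2 * 2 ^ (m + 1) ≤ δ ^ 2 * (32 * √(β + 1) * Q) := by gcongr
        _ = _ := by ring
    linarith
  · set ρ : ℝ := (β + 1) ^ (1 / 4 : ℝ) with hρ
    have hρ0 : 0 < ρ := Real.rpow_pos_of_pos (by linarith) _
    have hρ2 : ρ ^ 2 = √(β + 1) := by
      rw [hρ, ← Real.rpow_natCast, ← Real.rpow_mul (by linarith), Real.sqrt_eq_rpow]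
      norm_num
    have hinv : 1 / a ≤ 6 * ρ := by
      rw [div_le_iff₀ ha0, ← one_le_sq_iff₀ (by positivity), mul_pow, mul_pow, hρ2, ha2]
      have h1 := mul_le_mul_of_nonneg_right hAle (sq_nonneg η)
      rw [div_mul_eq_mul_div, mul_comm, hη2, mul_comm] at h1
      rw [div_le_iff₀ (by positivity)] at h1
      nlinarith [mul_pos (mul_pos hA0 (pow_pos hη0 2)) hs0]
    have hnat : P.length + (D * (40 * m + 61 + 19) + 1) + (m + j + 1) + 1 ≤
        85 * ((m + j + 1) * (D + 1)) := by
      have : D * (40 * m + 61 + 19) ≤ 80 * ((m + j + 1) * D) := by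
        rw [mul_comm (m + j + 1) D, ← mul_assoc, mul_comm 80 D, mul_assoc]
        exact Nat.mul_le_mul_left D (by omega)
      have e : (m + j + 1) * (D + 1) = (m + j + 1) * D + (m + j + 1) := Nat.mul_succ _ _
      omega
    have hreal : ((P.length : ℝ) + ((D * (40 * m + 61 + 19) + 1 : ℕ) : ℝ) +
        (Fintype.card (Fin (m + j + 1)) : ℝ) + 1) ≤ 85 * (((m + j + 1 : ℕ) : ℝ) * (D + 1)) := by
      rw [Fintype.card_fin]
      exact_mod_cast hnat
    rw [div_eq_mul_one_div]
    calc 3000 * (((P.length : ℝ) + ((D * (40 * m + 61 + 19) + 1 : ℕ) : ℝ) +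
          (Fintype.card (Fin (m + j + 1)) : ℝ) + 1) * (1 / a))
        ≤ 3000 * ((85 * (((m + j + 1 : ℕ) : ℝ) * (D + 1))) * (6 * ρ)) := by gcongr
      _ = _ := by ring

/-! ### The choice of the parameters -/

theorem canPrepare_zero_qubits {F : ℝ → ℝ} (hF : 0 < F (-1)) {ε : ℝ} (hε : 0 ≤ ε) {G : ℝ}
    (hG : 0 ≤ G) : CanPrepare (functionState F (-1) 1 0) ε G := by
  have h : functionState F (-1) 1 0 = zeroState (Fin 0) := by
    ext x
    have hx : x = fun _ => false := Subsingleton.elim _ _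
    have hg : gridPoint (-1) 1 0 0 = -1 := by simp [gridPoint]
    simp [functionState, gridNorm, zeroState_apply, hx, bitsToNat, hg, Real.sqrt_sq_eq_abs,
      abs_of_pos hF, div_self hF.ne', -Complex.ofReal_div]
  refine canPrepare_of_runCircuit (A := Fin 0) [] (zeroState (Fin 0)) _ ?_ ?_ ?_ (by simpa using hG)
  · rw [runCircuit_nil, zeroState_sum]
  · rw [h]; simp [zeroState_apply, Subsingleton.elim _ (fun _ : Fin 0 => false)]
  · rw [h]; simpa using hε

theorem log_two_lt_log_one_div {ε : ℝ} (hε : 0 < ε) (hε2 : ε < 1 / 2) :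
    Real.log 2 < Real.log (1 / ε) := by
  refine Real.log_lt_log (by norm_num) ?_
  rw [lt_div_iff₀ hε]
  linarith

theorem exp_neg_log_one_div {ε : ℝ} (hε : 0 < ε) : Real.exp (-Real.log (1 / ε)) = ε := by
  rw [one_div, Real.log_inv, neg_neg, Real.exp_log hε]

/-- The truncation at a power of the order of `β + log (1 / ε)` suffices for the precision `ε`. -/
theorem canPrepare_window (m j : ℕ) [DecidablePred (InWindow m j)] {f F : ℝ → ℝ}
    {β : ℝ} {w : ℕ → ℝ} (h : IsPowerMixture f β w) (hβ : 0 ≤ β)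
    (hF : ∀ x, |x * 2 ^ j| ≤ 1 → F x = f (x * 2 ^ j)) {ε : ℝ} (hε : 0 < ε) (hε2 : ε < 1 / 2)
    (hτ : ∑ x : Fin (m + j + 1) → Bool, (if InWindow m j x then 0 else
        F (gridPoint (-1) 1 (m + j + 1) (bitsToNat x)) ^ 2) ≤
      ε ^ 2 / 8 * ∑ x : Fin (m + j + 1) → Bool,
        F (gridPoint (-1) 1 (m + j + 1) (bitsToNat x)) ^ 2) :
    CanPrepare (functionState F (-1) 1 (m + j + 1)) ε
      (20000000 * ((m + j + 1 : ℕ) * (β + 1) ^ (1 / 4 : ℝ) * (β + Real.log (1 / ε)))) := by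
  set L := Real.log (1 / ε) with hL
  have hL2 : Real.log 2 < L := log_two_lt_log_one_div hε hε2
  have hlog2 := Real.log_two_gt_d9
  obtain ⟨D, hD⟩ : ∃ D : ℕ, D = ⌈(L + 3 * β) / Real.log 2 + 4⌉₊ := ⟨_, rfl⟩
  have hD1 : (L + 3 * β) / Real.log 2 + 4 ≤ D := hD ▸ Nat.le_ceil _
  have hD2 : (D : ℝ) ≤ (L + 3 * β) / Real.log 2 + 4 + 1 :=
    hD ▸ (Nat.ceil_lt_add_one
      (add_nonneg (div_nonneg (by linarith) (by linarith)) (by norm_num))).le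
  have hδ : Real.exp (2 * β) / 2 ^ D ≤ ε / 16 * Real.exp (-β) := by
    have h2D : (2 : ℝ) ^ D = Real.exp (D * Real.log 2) := by
      rw [mul_comm, Real.exp_mul, Real.exp_log (by norm_num), Real.rpow_natCast]
    have h16 : (1 : ℝ) / 16 = Real.exp (-(4 * Real.log 2)) := by
      rw [Real.exp_neg, show (4 : ℝ) = ((4 : ℕ) : ℝ) by norm_num, Real.exp_nat_mul,
        Real.exp_log (by norm_num)]
      norm_num
    have hr : ε / 16 * Real.exp (-β) = Real.exp (-L - 4 * Real.log 2 - β) := by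
      rw [div_eq_mul_one_div, h16, ← exp_neg_log_one_div hε, ← Real.exp_add, ← Real.exp_add, ← hL]
      congr 1
    rw [hr, h2D, ← Real.exp_sub]
    refine Real.exp_le_exp.2 ?_
    have := mul_le_mul_of_nonneg_right hD1 (by linarith : 0 ≤ Real.log 2)
    rw [add_mul, div_mul_cancel₀ _ (by linarith)] at this
    linarith
  have hexp1 : Real.exp (-β) ≤ 1 := Real.exp_le_one_iff.2 (by linarith)
  have hexp0 := Real.exp_pos (-β)
  refine (fun H => ?_) (canPrepare_of_isPowerMixture m j h hβ hF hτ D ?_ hε.le ?_)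
  · obtain ⟨M, gates, h1, h2⟩ := H
    refine ⟨M, gates, h1.trans ?_, h2⟩
    have hDb : (D : ℝ) + 1 ≤ 11 * (β + L) := by
      have : (L + 3 * β) / Real.log 2 ≤ 2 * (L + 3 * β) := by
        rw [div_le_iff₀ (by linarith)]
        nlinarith
      linarith
    have hρ : 0 ≤ (β + 1) ^ (1 / 4 : ℝ) := Real.rpow_nonneg (by linarith) _
    have hβL : 0 ≤ β + L := by linarith
    calc 1530000 * (((m + j + 1 : ℕ) : ℝ) * (β + 1) ^ (1 / 4 : ℝ) * (D + 1))
        ≤ 1530000 * (((m + j + 1 : ℕ) : ℝ) * (β + 1) ^ (1 / 4 : ℝ) * (11 * (β + L))) := by gcongr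
      _ = 16830000 * (((m + j + 1 : ℕ) : ℝ) * (β + 1) ^ (1 / 4 : ℝ) * (β + L)) := by ring
      _ ≤ _ := by gcongr; norm_num
  · nlinarith
  · have hsq : (Real.exp (2 * β) / 2 ^ D) ^ 2 * √(β + 1) ≤ ε ^ 2 / 256 := by
      have h1 : (Real.exp (2 * β) / 2 ^ D) ^ 2 ≤ (ε / 16 * Real.exp (-β)) ^ 2 :=
        pow_le_pow_left₀ (by positivity) hδ 2
      have h2 : √(β + 1) ≤ Real.exp β := by
        refine Real.sqrt_le_iff.2 ⟨(Real.exp_pos _).le, ?_⟩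
        have h3 := Real.add_one_le_exp β
        nlinarith
      calc _ ≤ (ε / 16 * Real.exp (-β)) ^ 2 * Real.exp β := by gcongr
        _ = ε ^ 2 / 256 * Real.exp (-β) * (Real.exp (-β) * Real.exp β) := by ring
        _ = ε ^ 2 / 256 * Real.exp (-β) := by
            rw [← Real.exp_add, neg_add_cancel, Real.exp_zero, mul_one]
        _ ≤ ε ^ 2 / 256 := mul_le_of_le_one_right (by positivity) hexp1
    linarith

theorem canPrepare_isPowerMixture (n : ℕ) {f : ℝ → ℝ} {β : ℝ} {w : ℕ → ℝ}
    (h : IsPowerMixture f β w) (hf : 0 < f (-1)) (hβ : 0 ≤ β) {ε : ℝ} (hε : 0 < ε)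
    (hε2 : ε < 1 / 2) :
    CanPrepare (functionState f (-1) 1 n) ε
      (20000000 * (n * (β + 1) ^ (1 / 4 : ℝ) * (β + Real.log (1 / ε)))) := by
  classical
  cases n with
  | zero => exact canPrepare_zero_qubits hf hε.le (by simp)
  | succ m =>
    refine canPrepare_window m 0 h hβ (fun x _ => by simp) hε hε2 ?_
    have : ∀ x, InWindow m 0 x := fun x i hi => by simp at hi
    simp only [this, if_true, Finset.sum_const_zero]
    exact mul_nonneg (by positivity) (Finset.sum_nonneg fun x _ => sq_nonneg _)

/-- Halving the distance from the centre of the grid maps at most three grid points to one. -/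
theorem sum_gaussianFun_le (m : ℕ) {β : ℝ} (hβ : 0 ≤ β) :
    ∑ k ∈ Finset.range (2 ^ (m + 1)), gaussianFun β (gridPoint (-1) 1 (m + 1) k) ≤
      3 * ∑ k ∈ Finset.range (2 ^ (m + 1)), gaussianFun β (gridPoint (-1) 1 (m + 1) k) ^ 2 := by
  set M := 2 ^ m with hM
  have h2M : 2 ^ (m + 1) = 2 * M := by rw [hM, pow_succ]; ring
  have hM0 : (0 : ℝ) < M := by rw [hM]; positivity
  have hgrid : ∀ k : ℕ, gridPoint (-1) 1 (m + 1) k = ((k : ℝ) - M) / M := by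
    intro k
    have : (2 : ℝ) ^ (m + 1) = 2 * M := by exact_mod_cast h2M
    rw [gridPoint, this]
    field_simp
    ring
  let e : ℕ → ℕ := fun k => if M ≤ k then M + (k - M) / 2 else M - (M - k) / 2
  have hmaps : ∀ k ∈ Finset.range (2 ^ (m + 1)), e k ∈ Finset.range (2 ^ (m + 1)) := by
    intro k hk
    rw [Finset.mem_range, h2M] at *
    simp only [e]
    split_ifs <;> omega
  have hle : ∀ k : ℕ, gaussianFun β (gridPoint (-1) 1 (m + 1) k) ≤
      gaussianFun β (gridPoint (-1) 1 (m + 1) (e k)) ^ 2 := by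
    intro k
    rw [gaussianFun, gaussianFun, ← Real.exp_nat_mul, hgrid, hgrid]
    refine Real.exp_le_exp.2 ?_
    have habs : 2 * |(e k : ℝ) - M| ≤ |(k : ℝ) - M| := by
      simp only [e]
      split_ifs with hk
      · obtain ⟨i, rfl⟩ := Nat.exists_eq_add_of_le hk
        rw [Nat.add_sub_cancel_left]
        push_cast
        rw [add_sub_cancel_left, add_sub_cancel_left, abs_of_nonneg (by positivity),
          abs_of_nonneg (by positivity)]
        exact_mod_cast Nat.mul_div_le i 2
      · obtain ⟨i, hi⟩ := Nat.exists_eq_add_of_le (not_le.1 hk).le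
        have h1 : M - k = i := by omega
        have h2 : (M : ℝ) = k + i := by exact_mod_cast hi
        have h3 : ((M - i / 2 : ℕ) : ℝ) = M - ((i / 2 : ℕ) : ℝ) :=
          Nat.cast_sub (by omega)
        rw [h1, h3, sub_sub_cancel_left, abs_neg, abs_of_nonneg (by positivity), h2,
          sub_add_cancel_left, abs_neg, abs_of_nonneg (by positivity)]
        exact_mod_cast Nat.mul_div_le i 2
    have hsq : 4 * ((e k : ℝ) - M) ^ 2 ≤ ((k : ℝ) - M) ^ 2 := by
      have := pow_le_pow_left₀ (by positivity) habs 2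
      rw [mul_pow, sq_abs, sq_abs] at this
      linarith
    rw [div_pow, div_pow]
    have h1 : 2 * (((e k : ℝ) - M) ^ 2 / M ^ 2) ≤ ((k : ℝ) - M) ^ 2 / M ^ 2 := by
      rw [mul_div_assoc']
      gcongr
      nlinarith [sq_nonneg ((e k : ℝ) - M)]
    push_cast
    nlinarith
  calc ∑ k ∈ Finset.range (2 ^ (m + 1)), gaussianFun β (gridPoint (-1) 1 (m + 1) k)
      ≤ ∑ k ∈ Finset.range (2 ^ (m + 1)), gaussianFun β (gridPoint (-1) 1 (m + 1) (e k)) ^ 2 :=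
        Finset.sum_le_sum fun k _ => hle k
    _ = ∑ l ∈ Finset.range (2 ^ (m + 1)), ∑ k ∈ Finset.range (2 ^ (m + 1)) with e k = l,
          gaussianFun β (gridPoint (-1) 1 (m + 1) (e k)) ^ 2 :=
        (Finset.sum_fiberwise_of_maps_to hmaps _).symm
    _ ≤ ∑ l ∈ Finset.range (2 ^ (m + 1)), 3 * gaussianFun β (gridPoint (-1) 1 (m + 1) l) ^ 2 := by
        refine Finset.sum_le_sum fun l _ => ?_
        rw [Finset.sum_congr rfl fun k hk => by rw [(Finset.mem_filter.1 hk).2],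
          Finset.sum_const, nsmul_eq_mul]
        gcongr
        have hsub : (Finset.range (2 ^ (m + 1))).filter (fun k => e k = l) ⊆
            Finset.Icc (2 * l - M - 1) (2 * l - M + 1) := by
          intro k hk
          have hk2 := (Finset.mem_filter.1 hk).2
          simp only [e] at hk2
          rw [Finset.mem_Icc]
          split_ifs at hk2 <;> omega
        have hcard := Finset.card_le_card hsub
        rw [Nat.card_Icc] at hcard
        exact_mod_cast hcard.trans (by omega)
    _ = _ := by rw [Finset.mul_sum]

/-- The weight of a Gaussian outside of the window `[-2⁻ʲ, 2⁻ʲ)`. -/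
theorem sum_gaussianFun_not_inWindow_le (m j : ℕ) [DecidablePred (InWindow m j)] {β : ℝ}
    (hβ : 0 ≤ β) :
    ∑ x : Fin (m + j + 1) → Bool, (if InWindow m j x then 0 else
        gaussianFun β (gridPoint (-1) 1 (m + j + 1) (bitsToNat x)) ^ 2) ≤
      3 * Real.exp (-(β / 4 ^ j) / 2) * ∑ x : Fin (m + j + 1) → Bool,
        gaussianFun β (gridPoint (-1) 1 (m + j + 1) (bitsToNat x)) ^ 2 := by
  have hterm : ∀ x : Fin (m + j + 1) → Bool, (if InWindow m j x then 0 else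
      gaussianFun β (gridPoint (-1) 1 (m + j + 1) (bitsToNat x)) ^ 2) ≤
      Real.exp (-(β / 4 ^ j) / 2) *
        gaussianFun β (gridPoint (-1) 1 (m + j + 1) (bitsToNat x)) := by
    intro x
    split_ifs with hx
    · rw [gaussianFun]; positivity
    · have h1 := one_le_gridPoint_of_not_inWindow x hx
      rw [gaussianFun, sq]
      gcongr
      set y := gridPoint (-1) 1 (m + j + 1) (bitsToNat x)
      have h2 : 1 ≤ y ^ 2 * 4 ^ j := by
        have := one_le_pow₀ h1 (n := 2)
        rw [sq_abs, mul_pow, ← pow_mul, mul_comm j 2, pow_mul] at this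
        norm_num at this
        exact this
      have h3 : β / 4 ^ j ≤ β * y ^ 2 := by
        rw [div_le_iff₀ (by positivity), mul_assoc]
        exact le_mul_of_one_le_right hβ h2
      linarith
  refine (Finset.sum_le_sum fun x _ => hterm x).trans ?_
  rw [← Finset.mul_sum,
    sum_bitsToNat (m + j + 1) (fun k => gaussianFun β (gridPoint (-1) 1 (m + j + 1) k)),
    sum_bitsToNat (m + j + 1) (fun k => gaussianFun β (gridPoint (-1) 1 (m + j + 1) k) ^ 2)]
  have := mul_le_mul_of_nonneg_left (sum_gaussianFun_le (m + j) hβ)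
    (Real.exp_pos (-(β / 4 ^ j) / 2)).le
  linarith

/-- For large `β` only a window around `0` matters, on which the Gaussian is, after rescaling, one
with a parameter of the order of `log (1 / ε)`. -/
theorem canPrepare_gaussianFun_of_le (n : ℕ) {β ε : ℝ} (hε : 0 < ε) (hε2 : ε < 1 / 2)
    (hβn : √β ≤ 2 ^ n) (hβε : Real.log (1 / ε) ≤ β) :
    CanPrepare (functionState (gaussianFun β) (-1) 1 n) ε
      (5000000000 * (n * Real.log (1 / ε) ^ (5 / 4 : ℝ))) := by
  classical
  set L := Real.log (1 / ε) with hL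
  have hL2 : Real.log 2 < L := log_two_lt_log_one_div hε hε2
  have hlog2 := Real.log_two_gt_d9
  have hL0 : 0 < L := by linarith
  have hβ : 0 < β := by linarith
  have hpos : 0 < gaussianFun β (-1) := Real.exp_pos _
  have hbound : ∀ b : ℝ, 0 ≤ b → b ≤ 64 * L →
      20000000 * ((n : ℝ) * (b + 1) ^ (1 / 4 : ℝ) * (b + L)) ≤
        5000000000 * (n * L ^ (5 / 4 : ℝ)) := by
    intro b hb0 hb
    have h1 : (b + 1) ^ (1 / 4 : ℝ) ≤ 3 * L ^ (1 / 4 : ℝ) := by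
      have h81 : (3 : ℝ) = 81 ^ (1 / 4 : ℝ) := by
        rw [show (81 : ℝ) = 3 ^ (4 : ℝ) by norm_num, ← Real.rpow_mul (by norm_num)]
        norm_num
      rw [h81, ← Real.mul_rpow (by norm_num) hL0.le]
      exact Real.rpow_le_rpow (by linarith) (by linarith) (by norm_num)
    have h2 : L ^ (5 / 4 : ℝ) = L ^ (1 / 4 : ℝ) * L := by
      rw [← Real.rpow_add_one hL0.ne']
      norm_num
    have h3 : 0 ≤ L ^ (1 / 4 : ℝ) := Real.rpow_nonneg hL0.le _
    rw [h2]
    calc 20000000 * ((n : ℝ) * (b + 1) ^ (1 / 4 : ℝ) * (b + L))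
        ≤ 20000000 * ((n : ℝ) * (3 * L ^ (1 / 4 : ℝ)) * (65 * L)) := by
          gcongr
          linarith
      _ = 3900000000 * (n * (L ^ (1 / 4 : ℝ) * L)) := by ring
      _ ≤ _ := by gcongr; norm_num
  rcases lt_or_ge β (16 * L) with hsmall | hlarge
  · obtain ⟨M, gates, h1, h2⟩ := canPrepare_isPowerMixture n (isPowerMixture_gaussianFun hβ.le)
      hpos hβ.le hε hε2
    exact ⟨M, gates, h1.trans (hbound β hβ.le (by linarith)), h2⟩
  · obtain ⟨j, hj1, hj2⟩ : ∃ j : ℕ, (4 : ℝ) ^ j ≤ β / (16 * L) ∧ β / (16 * L) < 4 ^ (j + 1) :=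
      exists_nat_pow_near ((one_le_div (by positivity)).2 hlarge) (by norm_num)
    have h4 : (0 : ℝ) < 4 ^ j := by positivity
    have hjn : j < n := by
      have hβ4 : β ≤ 4 ^ n := by
        have := pow_le_pow_left₀ (Real.sqrt_nonneg _) hβn 2
        rw [Real.sq_sqrt hβ.le, ← pow_mul, mul_comm n 2, pow_mul] at this
        norm_num at this
        exact this
      have : (4 : ℝ) ^ j < 4 ^ n := by
        refine hj1.trans_lt ((div_lt_self hβ (by linarith)).trans_le hβ4)
      exact (pow_lt_pow_iff_right₀ (by norm_num)).1 this
    obtain ⟨m, rfl⟩ : ∃ m, n = m + j + 1 := ⟨n - j - 1, by omega⟩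
    set b := β / 4 ^ j with hb
    have hb0 : 0 ≤ b := by positivity
    have hb1 : 16 * L ≤ b := by
      rw [hb, le_div_iff₀ h4]
      rw [le_div_iff₀ (by positivity)] at hj1
      linarith
    have hb2 : b ≤ 64 * L := by
      rw [hb, div_le_iff₀ h4]
      rw [div_lt_iff₀ (by positivity), pow_succ] at hj2
      linarith
    have hF : ∀ x, |x * 2 ^ j| ≤ 1 → gaussianFun β x = gaussianFun b (x * 2 ^ j) := by
      intro x _
      have h22 : ((2 : ℝ) ^ j) ^ 2 = 4 ^ j := by
        rw [← pow_mul, mul_comm j 2, pow_mul]; norm_num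
      rw [gaussianFun, gaussianFun, mul_pow, h22, hb]
      congr 1
      field_simp
    obtain ⟨M, gates, h1, h2⟩ := canPrepare_window m j (isPowerMixture_gaussianFun hb0) hb0 hF hε
      hε2 (by
        refine (sum_gaussianFun_not_inWindow_le m j hβ.le).trans
          (mul_le_mul_of_nonneg_right ?_ (Finset.sum_nonneg fun x _ => sq_nonneg _))
        -- of the exponent `b / 2 ≥ 8 * L`, a part `2 * L` gives `ε ^ 2`, and
        -- `24 < exp 4 < exp (6 * L)`
        have h24 : Real.exp (-b / 2) ≤ ε ^ 2 * Real.exp (-4) := by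
          rw [← exp_neg_log_one_div hε, ← Real.exp_nat_mul, ← Real.exp_add, ← hL]
          refine Real.exp_le_exp.2 ?_
          push_cast
          linarith
        have he : Real.exp (-4) * 24 ≤ 1 := by
          rw [Real.exp_neg, inv_mul_le_iff₀ (Real.exp_pos _), mul_one]
          have h5 := Real.exp_one_gt_d9
          have h6 : Real.exp 4 = Real.exp 1 ^ 4 := by
            rw [← Real.exp_nat_mul]; norm_num
          have h7 : (2.7 : ℝ) ^ 4 ≤ Real.exp 1 ^ 4 :=
            pow_le_pow_left₀ (by norm_num) (by linarith) 4
          rw [h6]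
          norm_num at h7
          linarith
        have h8 := mul_le_mul_of_nonneg_left he (sq_nonneg ε)
        change 3 * Real.exp (-b / 2) ≤ ε ^ 2 / 8
        linarith)
    exact ⟨M, gates, h1.trans (hbound b hb0 hb2), h2⟩

theorem theorem3 :
    (∃ C : ℝ, 0 < C ∧
      ∀ (n : ℕ) (β ε : ℝ), 0 < ε → ε < 1 / 2 → 0 ≤ β → √β ≤ (2 : ℝ) ^ n →
        ∀ f : ℝ → ℝ, (f = gaussianFun β ∨ f = kaiserWindow β) →
          CanPrepare (functionState f (-1) 1 n) ε
            (C * (n * (β + 1) ^ (1 / 4 : ℝ) * (β + Real.log (1 / ε))))) ∧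
    (∃ C : ℝ, 0 < C ∧
      ∀ (n : ℕ) (β ε : ℝ), 0 < ε → ε < 1 / 2 → 0 ≤ β → √β ≤ (2 : ℝ) ^ n →
        Real.log (1 / ε) ≤ β →
          CanPrepare (functionState (gaussianFun β) (-1) 1 n) ε
            (C * (n * Real.log (1 / ε) ^ (5 / 4 : ℝ)))) := by
  refine ⟨⟨20000000, by norm_num, ?_⟩, ⟨5000000000, by norm_num, ?_⟩⟩
  · rintro n β ε hε hε2 hβ - f (rfl | rfl)
    · exact canPrepare_isPowerMixture n (isPowerMixture_gaussianFun hβ) (Real.exp_pos _) hβ hε hε2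
    · refine canPrepare_isPowerMixture n (isPowerMixture_kaiserWindow hβ) ?_ hβ hε hε2
      exact div_pos (by linarith [one_le_besselI0 (β * √(1 - (-1) ^ 2))])
        (by linarith [one_le_besselI0 β])
  · intro n β ε hε hε2 _ hβn hβε
    exact canPrepare_gaussianFun_of_le n hε hε2 hβn hβε
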